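/- For a weight $w\ge 0$ on $\mathbb{R}$ and real polynomials $p_n$ ($\deg p_n=n$, $n\ge 0$) orthonormal with respect to $w(\xi)\,d\xi$, the level-one first-kind functions generated by $(w,p)$ are $$\frac{i^n}{\sqrt{2\pi}}\int_{-\infty}^{\infty}e^{ix\xi}\,p_n(\xi)\,\sqrt{\frac{w(\xi)}{1+\xi^2}}\;d\xi,\qquad x\in\mathbb{R},\ n\ge 0 .$$ Let $L_n(\xi)=\sum_{\ell=0}^n(-1)^\ell\binom n\ell\frac{\xi^\ell}{\ell!}$ be the Laguerre polynomials. For $n\ge 0$ let $\varphi_n^{\langle1\rangle}$ be the functions generated by the Laguerre weight $e^{-\xi}\chi_{[0,\infty)}(\xi)$ and $p_n=L_n$, and let $\varphi_{-n-1}^{\langle1\rangle}$ be the functions generated by the mirrored weight $e^{\xi}\chi_{(-\infty,0]}(\xi)$ and its orthonormal polynomials with the sign normalization $p_n(\xi)=-L_n(-\xi)$. Let $g(z)=Y_0(z)-\mathbf{H}_0(z)$, where $Y_0$ is the Bessel function of the second kind (Weber function) and $\mathbf{H}_0$ the Struve function, both of order $0$ (principal branches). Then $(L_n)_{n\ge0}$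 and $(-L_n(-\xi))_{n\ge0}$ are orthonormal with respect to the Laguerre weight and the mirrored weight respectively, all the integrals above converge absolutely, $g$ is analytic at $\frac12-ix$ for every $x\in\mathbb{R}$, and for all $n\ge 0$ and $x\in\mathbb{R}$ $$\varphi_n^{\langle1\rangle}(x)=-\frac{\sqrt{2\pi}}{4}\,i^n\sum_{\ell=0}^n\binom n\ell\frac1{\ell!}\,g^{(\ell)}\!\left(\tfrac12-ix\right),\qquad \varphi_{-n-1}^{\langle1\rangle}(x)=(-1)^{n+1}\,\overline{\varphi_n^{\langle1\rangle}(x)} .$$ More generally, if $(q_n)_{n\ge 0}$ is any sequence of real orthonormal polynomials ($\deg q_n=n$) for the mirrored weight, then $q_n(0)\in\{1,-1\}$ and the $n$th first-kind function generated by the mirrored weight and $(q_n)$ equals $(-1)^n q_n(0)\,\overline{\varphi_n^{\langle1\rangle}}$. -/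

import Mathlib

open scoped Nat ComplexConjugate

noncomputable section

namespace SobolevLaguerre

/-- A sequence of real polynomials, `p n` of exact degree `n`, orthonormal with respect to the
weight `w`: all products are integrable against `w`, and `∫ p_m p_n w = δ_{mn}`. -/
def IsOrthonormalSystem (w : ℝ → ℝ) (p : ℕ → Polynomial ℝ) : Prop :=
  (∀ n, (p n).natDegree = n) ∧
    ∀ m n, MeasureTheory.Integrable (fun ξ : ℝ => (p m).eval ξ * (p n).eval ξ * w ξ) ∧
      ∫ ξ : ℝ, (p m).eval ξ * (p n).eval ξ * w ξ = if m = n then 1 else 0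

/-- The integrand `e^{ixξ} p(ξ) √(w(ξ) / ∑_{k=0}^s ξ^{2k})`. -/
def firstKindIntegrand (w : ℝ → ℝ) (p : Polynomial ℝ) (s : ℕ) (x ξ : ℝ) : ℂ :=
  Complex.exp (Complex.I * x * ξ) * (p.eval ξ : ℝ) *
    (Real.sqrt (w ξ / ∑ k ∈ Finset.range (s + 1), ξ ^ (2 * k)) : ℝ)

/-- The `n`-th function of level `s` of the Sobolev cascade of the first kind generated by the
weight `w` and the polynomials `p` (orthonormal with respect to `w`). -/
def firstKind (w : ℝ → ℝ) (p : ℕ → Polynomial ℝ) (s n : ℕ) (x : ℝ) : ℂ :=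
  Complex.I ^ n / (Real.sqrt (2 * Real.pi) : ℝ) * ∫ ξ : ℝ, firstKindIntegrand w (p n) s x ξ

/-- The Laguerre weight `e^{-ξ} χ_{[0,∞)}(ξ)`. -/
def laguerreWeight (ξ : ℝ) : ℝ := (Set.Ici (0 : ℝ)).indicator (fun t => Real.exp (-t)) ξ

/-- The mirrored Laguerre weight `e^{ξ} χ_{(-∞,0]}(ξ)`. -/
def mirrorWeight (ξ : ℝ) : ℝ := (Set.Iic (0 : ℝ)).indicator (fun t => Real.exp t) ξ

/-- The Laguerre polynomial `L_n(ξ) = ∑_{ℓ=0}^n (-1)^ℓ C(n,ℓ) ξ^ℓ / ℓ!`. -/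
def laguerre (n : ℕ) : Polynomial ℝ :=
  ∑ l ∈ Finset.range (n + 1),
    Polynomial.C ((-1 : ℝ) ^ l * (n.choose l : ℝ) / (l ! : ℝ)) * Polynomial.X ^ l

/-- The polynomials `-L_n(-ξ)`. Orthonormal polynomials are determined by their weight only up to
sign; these are the ones for `mirrorWeight` that take the value `-1` at the origin. -/
def mirrorLaguerre (n : ℕ) : Polynomial ℝ := -(laguerre n).comp (-Polynomial.X)

/-- The Sobolev-Laguerre functions of the first kind with `s = 1`, indexed by `ℤ`: the index
`n ≥ 0` belongs to the Laguerre weight, the index `-n-1` (with `n ≥ 0`) is the `n`-th function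
generated by the mirrored weight. -/
def sobolevLaguerre : ℤ → ℝ → ℂ
  | Int.ofNat n => firstKind laguerreWeight laguerre 1 n
  | Int.negSucc n => firstKind mirrorWeight mirrorLaguerre 1 n

/-- The Bessel function of the first kind, of complex order (principal branch):
`J_ν(z) = (z/2)^ν ∑_k (-1)^k (z²/4)^k / (k! Γ(ν+k+1))`. At a pole of `Γ` the value
`(Complex.Gamma _)⁻¹` is `0`, which is the value there of the entire function `1/Γ`. -/
def besselJ (ν z : ℂ) : ℂ :=
  (z / 2) ^ ν * ∑' k : ℕ, (-1) ^ k * (z ^ 2 / 4) ^ k * ((k ! : ℂ) * Complex.Gamma (ν + k + 1))⁻¹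

/-- The Bessel function of the second kind (Weber function) of integer order,
`Y_n(z) = (1/π) ∂J_ν(z)/∂ν |_{ν=n} + ((-1)^n/π) ∂J_ν(z)/∂ν |_{ν=-n}`. -/
def besselY (n : ℤ) (z : ℂ) : ℂ :=
  (deriv (fun ν : ℂ => besselJ ν z) n + (-1) ^ n * deriv (fun ν : ℂ => besselJ ν z) (-n)) /
    (Real.pi : ℂ)

/-- The Struve function
`H_ν(z) = (z/2)^{ν+1} ∑_k (-1)^k (z/2)^{2k} / (Γ(k+3/2) Γ(k+ν+3/2))`. -/
def struveH (ν z : ℂ) : ℂ :=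
  (z / 2) ^ (ν + 1) * ∑' k : ℕ, (-1) ^ k * (z / 2) ^ (2 * k) *
    (Complex.Gamma (k + 3 / 2) * Complex.Gamma (k + ν + 3 / 2))⁻¹

/-- `g = Y_0 - H_0`. -/
def weberStruve (z : ℂ) : ℂ := besselY 0 z - struveH 0 z

end SobolevLaguerre

end

/-! On the half-line the square root of the weight is `e^{-ξ/2}`, so expanding `L_n` turns the
integral into a combination of derivatives of the Laplace transform `F(z) = ∫_0^∞ e^{-zξ}
(1+ξ²)^{-1/2} dξ` at `z = 1/2 - ix`: each factor `(-ξ)^l` is one `l`-fold differentiation. What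
remains is the classical identity `F = -(π/2)(Y_0 - H_0)` on `Re z > 0`, which is `weberStruve_eq`.

For it, let `D = F + (π/2)(Y_0 - H_0)`. `F` solves `z y'' + y' + z y = 1`
(`laplaceMoment_bessel_equation`), and the series of `(π/2) H_0` solves the same equation, so `D`
solves the homogeneous Bessel equation. Matching `F(t) = -log t + log 2 - γ + o(1)` and `t F'(t) →
-1` with the logarithmic series of `Y_0` shows that `D` and `z D'` tend to `0` at `0+`. Since `0` is
a singular point of the equation, uniqueness needs its own argument
(`eventually_eq_zero_of_bessel_system`); the identity theorem then spreads `D = 0` over the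
half-plane.

Negative indices come from the reflection `ξ ↦ -ξ`, which conjugates the exponential and leaves the
other factors real. Orthonormality of the `L_n` is a statement about `n`-th finite differences of
polynomials of degree at most `n`. -/

namespace SobolevLaguerre

open MeasureTheory Polynomial

/-! ### Orthonormal polynomials and their uniqueness up to sign -/

section OrthonormalSystems

variable {w : ℝ → ℝ} {p q : ℕ → Polynomial ℝ}

/-- A polynomial whose coefficients vanish from `N` on is a combination of the first `N` members of
a sequence of polynomials with `(p n).natDegree = n`, provided `p 0 ≠ 0`. -/
theorem exists_eq_sum_of_coeff_eq_zero (hdeg : ∀ n, (p n).natDegree = n) (h0 : p 0 ≠ 0) (N : ℕ)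
    (r : Polynomial ℝ) (hr : ∀ k, N ≤ k → r.coeff k = 0) :
    ∃ a : ℕ → ℝ, r = ∑ j ∈ Finset.range N, C (a j) * p j := by
  induction N generalizing r with
  | zero => exact ⟨0, by ext k; simpa using hr k (Nat.zero_le k)⟩
  | succ N ih =>
    have hlead : (p N).coeff N ≠ 0 := by
      have hne : p N ≠ 0 := by
        rcases Nat.eq_zero_or_pos N with rfl | hN
        · exact h0
        · intro h
          have := hdeg N
          rw [h, natDegree_zero] at this
          omega
      have := leadingCoeff_ne_zero.mpr hne
      rwa [leadingCoeff, hdeg N] at this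
    -- Subtracting this multiple of `p N` removes the coefficient of degree `N`.
    obtain ⟨a, ha⟩ := ih (r - C (r.coeff N / (p N).coeff N) * p N) (by
      intro k hk
      rw [coeff_sub, coeff_C_mul]
      rcases hk.eq_or_lt with rfl | hk
      · field_simp
        ring
      · rw [hr k hk, coeff_eq_zero_of_natDegree_lt (p := p N) (n := k) (by rw [hdeg]; exact hk)]
        simp)
    refine ⟨fun j => if j = N then r.coeff N / (p N).coeff N else a j, ?_⟩
    simp only [Finset.sum_range_succ, if_true]
    rw [← sub_eq_iff_eq_add, ha]
    refine Finset.sum_congr rfl fun j hj => ?_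
    rw [if_neg (Finset.mem_range.mp hj).ne]

/-- Since `natDegree 0 = 0`, the degree condition alone would allow `p 0 = 0`; the normalization
excludes it. -/
theorem IsOrthonormalSystem.zero_ne_zero (hp : IsOrthonormalSystem w p) : p 0 ≠ 0 := by
  intro h
  have := (hp.2 0 0).2
  simp [h] at this

theorem IsOrthonormalSystem.integral_sum_mul (hp : IsOrthonormalSystem w p) (a : ℕ → ℝ)
    (N k : ℕ) :
    ∫ ξ : ℝ, (∑ j ∈ Finset.range N, C (a j) * p j).eval ξ * (p k).eval ξ * w ξ =
      if k < N then a k else 0 := by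
  have h : ∀ ξ : ℝ, (∑ j ∈ Finset.range N, C (a j) * p j).eval ξ * (p k).eval ξ * w ξ =
      ∑ j ∈ Finset.range N, a j * ((p j).eval ξ * (p k).eval ξ * w ξ) := by
    intro ξ
    simp only [eval_finsetSum, eval_mul, eval_C, Finset.sum_mul, mul_assoc]
  simp_rw [h]
  rw [integral_finsetSum _ fun j _ => (hp.2 j k).1.const_mul _]
  simp_rw [integral_const_mul, (hp.2 _ k).2]
  simp

/-- Orthonormal polynomials are determined by the weight up to sign. -/
theorem IsOrthonormalSystem.eq_or_eq_neg (hp : IsOrthonormalSystem w p)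
    (hq : IsOrthonormalSystem w q) (n : ℕ) :
    ∃ c : ℝ, (c = 1 ∨ c = -1) ∧ q n = C c * p n := by
  obtain ⟨a, ha⟩ := exists_eq_sum_of_coeff_eq_zero hp.1 hp.zero_ne_zero (n + 1) (q n)
    fun k hk => coeff_eq_zero_of_natDegree_lt (by rw [hq.1]; exact hk)
  -- `a k` is the integral of `q n * p k * w`, and `p k` is a combination of `q 0, …, q k`, all
  -- orthogonal to `q n`.
  have hzero : ∀ k < n, a k = 0 := by
    intro k hk
    obtain ⟨b, hb⟩ := exists_eq_sum_of_coeff_eq_zero hq.1 hq.zero_ne_zero (k + 1) (p k)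
      fun j hj => coeff_eq_zero_of_natDegree_lt (by rw [hp.1]; exact hj)
    have h1 := hp.integral_sum_mul a (n + 1) k
    have h2 := hq.integral_sum_mul b (k + 1) n
    rw [← ha, if_pos (by omega)] at h1
    rw [← hb, if_neg (by omega)] at h2
    rw [← h1, ← h2]
    exact integral_congr_ae (ae_of_all _ fun ξ => by ring)
  have hqn : q n = C (a n) * p n := by
    rw [ha, Finset.sum_range_succ, Finset.sum_eq_zero, zero_add]
    intro k hk
    rw [hzero k (Finset.mem_range.mp hk), C_0, zero_mul]
  refine ⟨a n, ?_, hqn⟩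
  have h := (hq.2 n n).2
  have h' : ∀ ξ : ℝ, (q n).eval ξ * (q n).eval ξ * w ξ =
      (a n * a n) * ((p n).eval ξ * (p n).eval ξ * w ξ) := by
    intro ξ
    rw [hqn, eval_mul, eval_C]
    ring
  simp_rw [h'] at h
  rw [integral_const_mul, (hp.2 n n).2] at h
  simp only [if_true, mul_one] at h
  exact mul_self_eq_one_iff.mp h

theorem IsOrthonormalSystem.comp_neg (hp : IsOrthonormalSystem w p) :
    IsOrthonormalSystem (fun ξ => w (-ξ)) (fun n => -(p n).comp (-X)) := by
  refine ⟨fun n => ?_, fun m n => ?_⟩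
  · rw [natDegree_neg, natDegree_comp, natDegree_neg, natDegree_X, hp.1, mul_one]
  · have h : (fun ξ : ℝ => (-(p m).comp (-X)).eval ξ * (-(p n).comp (-X)).eval ξ * w (-ξ)) =
        fun ξ : ℝ => (fun t : ℝ => (p m).eval t * (p n).eval t * w t) (-ξ) := by
      ext ξ
      simp [eval_comp]
    rw [h]
    refine ⟨(hp.2 m n).1.comp_neg, ?_⟩
    rw [integral_neg_eq_self (fun t : ℝ => (p m).eval t * (p n).eval t * w t)]
    exact (hp.2 m n).2

end OrthonormalSystems

/-! ### Orthonormality of the Laguerre polynomials -/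

section LaguerrePolynomials

theorem coeff_laguerre (n k : ℕ) :
    (laguerre n).coeff k = (-1 : ℝ) ^ k * (n.choose k : ℝ) / (k ! : ℝ) := by
  simp only [laguerre, finsetSum_coeff, coeff_C_mul, coeff_X_pow, mul_ite, mul_one, mul_zero,
    Finset.sum_ite_eq, Finset.mem_range]
  split_ifs with h
  · rfl
  · rw [Nat.choose_eq_zero_of_lt (by omega)]
    simp

theorem natDegree_laguerre (n : ℕ) : (laguerre n).natDegree = n := by
  refine le_antisymm (natDegree_le_iff_coeff_eq_zero.mpr fun k hk => ?_)
    (le_natDegree_of_ne_zero ?_)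
  · rw [coeff_laguerre, Nat.choose_eq_zero_of_lt hk]
    simp
  · rw [coeff_laguerre, Nat.choose_self]
    positivity

theorem eval_laguerre (n : ℕ) (ξ : ℝ) : (laguerre n).eval ξ =
    ∑ l ∈ Finset.range (n + 1), (-1 : ℝ) ^ l * (n.choose l : ℝ) / (l ! : ℝ) * ξ ^ l := by
  simp [laguerre, eval_finsetSum]

theorem eval_zero_laguerre (n : ℕ) : (laguerre n).eval 0 = 1 := by
  rw [← coeff_zero_eq_eval_zero, coeff_laguerre]
  simp

theorem pow_mul_laguerreWeight (k : ℕ) : (fun ξ : ℝ => ξ ^ k * laguerreWeight ξ) =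
    (Set.Ici (0 : ℝ)).indicator (fun ξ => Real.exp (-ξ) * ξ ^ ((k + 1 : ℝ) - 1)) := by
  ext ξ
  by_cases h : ξ ∈ Set.Ici (0 : ℝ) <;> simp [laguerreWeight, h, mul_comm]

theorem integrable_pow_mul_laguerreWeight (k : ℕ) :
    Integrable (fun ξ : ℝ => ξ ^ k * laguerreWeight ξ) := by
  rw [pow_mul_laguerreWeight, integrable_indicator_iff measurableSet_Ici,
    integrableOn_Ici_iff_integrableOn_Ioi]
  exact Real.GammaIntegral_convergent (by positivity)

theorem integral_pow_mul_laguerreWeight (k : ℕ) :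
    ∫ ξ : ℝ, ξ ^ k * laguerreWeight ξ = k ! := by
  rw [pow_mul_laguerreWeight, integral_indicator measurableSet_Ici, integral_Ici_eq_integral_Ioi,
    ← Real.Gamma_eq_integral (by positivity), Real.Gamma_nat_eq_factorial]

theorem integrable_eval_mul_laguerreWeight (r : Polynomial ℝ) :
    Integrable (fun ξ : ℝ => r.eval ξ * laguerreWeight ξ) := by
  simp_rw [eval_eq_sum_range, Finset.sum_mul, mul_assoc]
  exact integrable_finsetSum _ fun i _ => (integrable_pow_mul_laguerreWeight i).const_mul _

/-- The quotient `(i + l)! / l! = (l + 1)⋯(l + i)` is a monic polynomial of degree `i` in `l`, and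
the alternating sum is `(-1)^n` times its `n`-th forward difference at `0`. That difference vanishes
for `i < n` and equals `n!` for `i = n`. -/
theorem sum_alternating_choose_mul_factorial_div {i n : ℕ} (hi : i ≤ n) :
    ∑ l ∈ Finset.range (n + 1), (-1 : ℝ) ^ l * (n.choose l : ℝ) / (l ! : ℝ) * ((i + l) ! : ℝ) =
      if i = n then (-1) ^ n * (n ! : ℝ) else 0 := by
  set P : Polynomial ℝ := (ascPochhammer ℝ i).comp (X + C 1) with hP
  have hmonic : P.Monic := (monic_ascPochhammer ℝ i).comp_X_add_C 1
  have hdeg : P.natDegree = i := by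
    rw [hP, natDegree_comp, natDegree_X_add_C, mul_one, ascPochhammer_natDegree]
  have heval : ∀ l : ℕ, P.eval (l : ℝ) = ((i + l) ! : ℝ) / (l ! : ℝ) := by
    intro l
    have h1 : P.eval (l : ℝ) = ((l + 1).ascFactorial i : ℝ) := by
      rw [hP, eval_comp, ← ascPochhammer_nat_eq_ascFactorial]
      rw [ascPochhammer_eval_cast]
      simp
    rw [h1, eq_div_iff (by positivity), add_comm i l, ← Nat.factorial_mul_ascFactorial]
    push_cast
    ring
  have hsum : ∑ l ∈ Finset.range (n + 1),
      (-1 : ℝ) ^ l * (n.choose l : ℝ) / (l ! : ℝ) * ((i + l) ! : ℝ) =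
        (-1) ^ n * (fwdDiff 1)^[n] P.eval 0 := by
    rw [fwdDiff_iter_eq_sum_shift, Finset.mul_sum]
    refine Finset.sum_congr rfl fun l hl => ?_
    have hl' : l ≤ n := Nat.lt_succ_iff.mp (Finset.mem_range.mp hl)
    have hsgn : (-1 : ℝ) ^ n * (-1) ^ (n - l) = (-1) ^ l := by
      obtain ⟨d, rfl⟩ := Nat.exists_eq_add_of_le hl'
      rw [Nat.add_sub_cancel_left, pow_add, mul_assoc, ← pow_add, ← two_mul, pow_mul]
      simp
    have h2 : (0 : ℝ) + l • (1 : ℝ) = l := by simp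
    rw [h2, heval, zsmul_eq_mul, ← hsgn]
    push_cast
    ring
  rw [hsum]
  split_ifs with h
  · have := P.fwdDiff_iter_degree_eq_factorial
    rw [hdeg, hmonic.leadingCoeff, one_smul, h] at this
    rw [this]
    simp
  · rw [Polynomial.fwdDiff_iter_eq_zero_of_degree_lt (by omega)]
    simp

/-- The moments of the weight are factorials, so each monomial `ξ^i` of `r` contributes the
alternating sum above; only `i = n` survives. -/
theorem integral_mul_laguerre_mul_laguerreWeight (r : Polynomial ℝ) {n : ℕ}
    (hr : r.natDegree ≤ n) :
    ∫ ξ : ℝ, r.eval ξ * (laguerre n).eval ξ * laguerreWeight ξ =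
      r.coeff n * ((-1) ^ n * (n ! : ℝ)) := by
  have h : ∀ ξ : ℝ, r.eval ξ * (laguerre n).eval ξ * laguerreWeight ξ =
      ∑ i ∈ Finset.range (n + 1), ∑ l ∈ Finset.range (n + 1),
        (r.coeff i * ((-1 : ℝ) ^ l * (n.choose l : ℝ) / (l ! : ℝ))) *
          (ξ ^ (i + l) * laguerreWeight ξ) := by
    intro ξ
    rw [eval_eq_sum_range' (Nat.lt_succ_of_le hr), eval_laguerre, Finset.sum_mul_sum,
      Finset.sum_mul]
    refine Finset.sum_congr rfl fun i _ => ?_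
    rw [Finset.sum_mul]
    exact Finset.sum_congr rfl fun l _ => by ring
  simp_rw [h]
  rw [integral_finsetSum _ fun i _ => integrable_finsetSum _ fun l _ =>
    (integrable_pow_mul_laguerreWeight (i + l)).const_mul _]
  have h' : ∀ i ∈ Finset.range (n + 1), ∫ ξ : ℝ, ∑ l ∈ Finset.range (n + 1),
        (r.coeff i * ((-1 : ℝ) ^ l * (n.choose l : ℝ) / (l ! : ℝ))) *
          (ξ ^ (i + l) * laguerreWeight ξ) =
      r.coeff i * if i = n then (-1) ^ n * (n ! : ℝ) else 0 := by
    intro i hi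
    rw [integral_finsetSum _ fun l _ =>
      (integrable_pow_mul_laguerreWeight (i + l)).const_mul _]
    simp_rw [integral_const_mul, integral_pow_mul_laguerreWeight, mul_assoc (r.coeff i)]
    rw [← Finset.mul_sum, sum_alternating_choose_mul_factorial_div
      (Nat.lt_succ_iff.mp (Finset.mem_range.mp hi))]
  rw [Finset.sum_congr rfl h']
  simp

theorem isOrthonormalSystem_laguerre : IsOrthonormalSystem laguerreWeight laguerre := by
  have key : ∀ m n, m ≤ n →
      ∫ ξ : ℝ, (laguerre m).eval ξ * (laguerre n).eval ξ * laguerreWeight ξ =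
        if m = n then 1 else 0 := by
    intro m n hmn
    rw [integral_mul_laguerre_mul_laguerreWeight _ (by rwa [natDegree_laguerre]), coeff_laguerre]
    split_ifs with h
    · subst h
      rw [Nat.choose_self, Nat.cast_one, mul_one, div_mul_eq_mul_div, ← mul_assoc, ← pow_add,
        ← two_mul, pow_mul]
      simp [Nat.factorial_ne_zero]
    · rw [Nat.choose_eq_zero_of_lt (by omega)]
      simp
  refine ⟨natDegree_laguerre, fun m n => ⟨?_, ?_⟩⟩
  · simpa only [eval_mul] using integrable_eval_mul_laguerreWeight (laguerre m * laguerre n)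
  · rcases le_total m n with h | h
    · exact key m n h
    · simp_rw [eq_comm (a := m)]
      rw [← key n m h]
      exact integral_congr_ae (ae_of_all _ fun ξ => by ring)

end LaguerrePolynomials

/-! ### Reflection to the mirrored weight -/

section Mirror

theorem mirrorWeight_eq (ξ : ℝ) : mirrorWeight ξ = laguerreWeight (-ξ) := by
  by_cases h : ξ ≤ 0 <;> simp [mirrorWeight, laguerreWeight, h]

theorem isOrthonormalSystem_mirrorLaguerre :
    IsOrthonormalSystem mirrorWeight mirrorLaguerre := by
  rw [show mirrorWeight = fun ξ => laguerreWeight (-ξ) from funext mirrorWeight_eq]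
  exact isOrthonormalSystem_laguerre.comp_neg

/-- Reflection replaces `e^{ixξ}` by its conjugate, and every other factor is real. The minus sign
is the normalization `-L_n(-ξ)`. -/
theorem firstKindIntegrand_mirror (n : ℕ) (x ξ : ℝ) :
    firstKindIntegrand mirrorWeight (mirrorLaguerre n) 1 x ξ =
      -conj (firstKindIntegrand laguerreWeight (laguerre n) 1 x (-ξ)) := by
  simp only [firstKindIntegrand, mirrorWeight_eq, mirrorLaguerre, eval_neg, eval_comp, eval_X,
    map_mul, ← Complex.exp_conj, Complex.conj_ofReal, Complex.conj_I, even_two_mul, Even.neg_pow]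
  push_cast
  ring_nf

theorem firstKind_mirror (n : ℕ) (x : ℝ) :
    firstKind mirrorWeight mirrorLaguerre 1 n x =
      (-1) ^ (n + 1) * conj (firstKind laguerreWeight laguerre 1 n x) := by
  simp only [firstKind, firstKindIntegrand_mirror, integral_neg]
  rw [integral_neg_eq_self
    (fun ξ => conj (firstKindIntegrand laguerreWeight (laguerre n) 1 x ξ)), integral_conj, map_mul,
    map_div₀, map_pow, Complex.conj_I, Complex.conj_ofReal, neg_pow Complex.I n, pow_succ]
  -- Conjugating `i^n` produces a second factor `(-1)^n`, which cancels against the one in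
  -- `(-1)^(n+1)`.
  have h : ((-1 : ℂ) ^ n) * (-1) ^ n = 1 := by rw [← mul_pow]; simp
  linear_combination (Complex.I ^ n / (Real.sqrt (2 * Real.pi) : ℝ) * conj (∫ ξ : ℝ,
    firstKindIntegrand laguerreWeight (laguerre n) 1 x ξ)) * h

theorem firstKind_const_mul (w : ℝ → ℝ) (p q : ℕ → Polynomial ℝ) (s n : ℕ) (c : ℝ)
    (h : q n = C c * p n) (x : ℝ) : firstKind w q s n x = c * firstKind w p s n x := by
  have hint : ∀ ξ : ℝ, firstKindIntegrand w (q n) s x ξ = c * firstKindIntegrand w (p n) s x ξ := by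
    intro ξ
    simp only [firstKindIntegrand, h, eval_mul, eval_C]
    push_cast
    ring
  simp only [firstKind, hint, integral_const_mul]
  ring

theorem eval_zero_mirrorLaguerre (n : ℕ) : (mirrorLaguerre n).eval 0 = -1 := by
  simp [mirrorLaguerre, eval_comp, eval_zero_laguerre]

theorem sobolevLaguerre_natCast (n : ℕ) (x : ℝ) :
    sobolevLaguerre n x = firstKind laguerreWeight laguerre 1 n x := rfl

theorem sobolevLaguerre_neg_sub_one (n : ℕ) (x : ℝ) :
    sobolevLaguerre (-(n : ℤ) - 1) x = (-1) ^ (n + 1) * conj (sobolevLaguerre n x) := by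
  rw [show (-(n : ℤ) - 1) = Int.negSucc n by rw [Int.negSucc_eq]; ring, sobolevLaguerre_natCast,
    ← firstKind_mirror]
  rfl

/-- By uniqueness `q n = c · mirrorLaguerre n` with `c = ±1`, and evaluation at `0` identifies `c`
as `-(q n)(0)`. -/
theorem firstKind_mirror_of_isOrthonormalSystem {q : ℕ → Polynomial ℝ}
    (hq : IsOrthonormalSystem mirrorWeight q) (n : ℕ) :
    ((q n).eval 0 = 1 ∨ (q n).eval 0 = -1) ∧
      ∀ x : ℝ, firstKind mirrorWeight q 1 n x =
        (-1) ^ n * ((q n).eval 0 : ℝ) * conj (sobolevLaguerre n x) := by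
  obtain ⟨c, hc, h⟩ := isOrthonormalSystem_mirrorLaguerre.eq_or_eq_neg hq n
  have h0 : (q n).eval 0 = -c := by
    rw [h, eval_mul, eval_C, eval_zero_mirrorLaguerre, mul_neg_one]
  refine ⟨?_, fun x => ?_⟩
  · rw [h0]
    rcases hc with rfl | rfl
    · exact Or.inr rfl
    · exact Or.inl (neg_neg 1)
  · rw [firstKind_const_mul mirrorWeight mirrorLaguerre q 1 n c h x, firstKind_mirror, h0,
      sobolevLaguerre_natCast]
    push_cast
    ring

end Mirror

end SobolevLaguerre

/-! ### The Laplace transform of `1 / √(1 + ξ²)` -/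

namespace SobolevLaguerre

open MeasureTheory Set Filter Topology

/-- The `l`-th derivative of the Laplace transform of `1 / √(1 + ξ²)`. -/
noncomputable def laplaceMoment (l : ℕ) (z : ℂ) : ℂ :=
  ∫ ξ : ℝ in Ioi 0, (-(ξ : ℂ)) ^ l * Complex.exp (-z * ξ) * ((Real.sqrt (1 + ξ ^ 2))⁻¹ : ℝ)

theorem integrableOn_pow_mul_exp_neg_mul (l : ℕ) {b : ℝ} (hb : 0 < b) :
    IntegrableOn (fun ξ : ℝ => ξ ^ l * Real.exp (-b * ξ)) (Ioi 0) := by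
  have h := integrableOn_rpow_mul_exp_neg_mul_rpow (p := 1) (s := l) (b := b)
    (lt_of_lt_of_le (by norm_num) l.cast_nonneg) one_pos hb
  simpa only [Real.rpow_natCast, Real.rpow_one] using h

theorem inv_sqrt_one_add_sq_le_one (ξ : ℝ) : (Real.sqrt (1 + ξ ^ 2))⁻¹ ≤ 1 :=
  inv_le_one_of_one_le₀ (Real.one_le_sqrt.mpr (by nlinarith [sq_nonneg ξ]))

theorem continuous_laplaceMoment_integrand (l : ℕ) (z : ℂ) : Continuous fun ξ : ℝ =>
    (-(ξ : ℂ)) ^ l * Complex.exp (-z * ξ) * ((Real.sqrt (1 + ξ ^ 2))⁻¹ : ℝ) := by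
  have h : Continuous fun ξ : ℝ => (Real.sqrt (1 + ξ ^ 2))⁻¹ :=
    Continuous.inv₀ (by fun_prop) fun ξ => (Real.sqrt_pos.mpr (by positivity)).ne'
  fun_prop

theorem norm_laplaceMoment_integrand_le (l : ℕ) {z : ℂ} {b ξ : ℝ} (hb : b ≤ z.re) (hξ : 0 < ξ) :
    ‖(-(ξ : ℂ)) ^ l * Complex.exp (-z * ξ) * ((Real.sqrt (1 + ξ ^ 2))⁻¹ : ℝ)‖ ≤
      ξ ^ l * Real.exp (-b * ξ) := by
  rw [norm_mul, norm_mul, norm_pow, norm_neg, Complex.norm_real, Complex.norm_real,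
    Complex.norm_exp, Real.norm_of_nonneg hξ.le, Real.norm_of_nonneg (by positivity)]
  have h1 : ((-z * ξ : ℂ)).re ≤ -b * ξ := by
    simp only [Complex.mul_re, Complex.neg_re, Complex.ofReal_re, Complex.ofReal_im, mul_zero,
      sub_zero]
    nlinarith
  calc ξ ^ l * Real.exp ((-z * ξ : ℂ)).re * (Real.sqrt (1 + ξ ^ 2))⁻¹
      ≤ ξ ^ l * Real.exp (-b * ξ) * 1 := by
        gcongr
        exact inv_sqrt_one_add_sq_le_one ξ
    _ = _ := mul_one _

theorem integrableOn_laplaceMoment (l : ℕ) {z : ℂ} (hz : 0 < z.re) :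
    IntegrableOn (fun ξ : ℝ => (-(ξ : ℂ)) ^ l * Complex.exp (-z * ξ) *
      ((Real.sqrt (1 + ξ ^ 2))⁻¹ : ℝ)) (Ioi 0) := by
  refine (integrableOn_pow_mul_exp_neg_mul l hz).mono'
    (continuous_laplaceMoment_integrand l z).aestronglyMeasurable ?_
  exact (ae_restrict_iff' measurableSet_Ioi).mpr
    (ae_of_all _ fun ξ hξ => norm_laplaceMoment_integrand_le l le_rfl hξ)

theorem hasDerivAt_laplaceMoment (l : ℕ) {z : ℂ} (hz : 0 < z.re) :
    HasDerivAt (laplaceMoment l) (laplaceMoment (l + 1) z) z := by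
  -- On this half-plane `e^{-(Re z / 2) ξ}` dominates the exponential uniformly.
  have hs : {y : ℂ | z.re / 2 < y.re} ∈ 𝓝 z :=
    (isOpen_lt continuous_const Complex.continuous_re).mem_nhds (by simpa using half_lt_self hz)
  refine (hasDerivAt_integral_of_dominated_loc_of_deriv_le
    (F := fun (y : ℂ) (ξ : ℝ) => (-(ξ : ℂ)) ^ l * Complex.exp (-y * ξ) *
      ((Real.sqrt (1 + ξ ^ 2))⁻¹ : ℝ))
    (F' := fun (y : ℂ) (ξ : ℝ) => (-(ξ : ℂ)) ^ (l + 1) * Complex.exp (-y * ξ) *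
      ((Real.sqrt (1 + ξ ^ 2))⁻¹ : ℝ))
    (bound := fun ξ : ℝ => ξ ^ (l + 1) * Real.exp (-(z.re / 2) * ξ)) hs ?_ ?_ ?_ ?_ ?_ ?_).2
  · exact Eventually.of_forall fun y =>
      (continuous_laplaceMoment_integrand l y).aestronglyMeasurable
  · exact integrableOn_laplaceMoment l hz
  · exact (continuous_laplaceMoment_integrand (l + 1) z).aestronglyMeasurable
  · exact (ae_restrict_iff' measurableSet_Ioi).mpr (ae_of_all _ fun ξ hξ y hy =>
      norm_laplaceMoment_integrand_le (l + 1) (le_of_lt hy) hξ)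
  · exact integrableOn_pow_mul_exp_neg_mul (l + 1) (half_pos hz)
  · refine ae_of_all _ fun ξ y _ => ?_
    have h : HasDerivAt (fun y : ℂ => Complex.exp (-y * ξ)) (Complex.exp (-y * ξ) * (-1 * ξ)) y :=
      ((hasDerivAt_id y).neg.mul_const (ξ : ℂ)).cexp
    refine ((h.const_mul ((-(ξ : ℂ)) ^ l)).mul_const
      (((Real.sqrt (1 + ξ ^ 2))⁻¹ : ℝ) : ℂ)).congr_deriv ?_
    ring

theorem iteratedDeriv_laplaceMoment_zero (l : ℕ) {z : ℂ} (hz : 0 < z.re) :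
    iteratedDeriv l (laplaceMoment 0) z = laplaceMoment l z := by
  induction l generalizing z with
  | zero => simp
  | succ l ih =>
    rw [iteratedDeriv_succ, EventuallyEq.deriv_eq (f := laplaceMoment l),
      (hasDerivAt_laplaceMoment l hz).deriv]
    filter_upwards [(isOpen_lt continuous_const Complex.continuous_re).mem_nhds hz] with y hy
    exact ih hy

theorem analyticOnNhd_laplaceMoment (l : ℕ) :
    AnalyticOnNhd ℂ (laplaceMoment l) {z : ℂ | 0 < z.re} :=
  DifferentiableOn.analyticOnNhd
    (fun _ hz => (hasDerivAt_laplaceMoment l hz).differentiableAt.differentiableWithinAt)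
    (isOpen_lt continuous_const Complex.continuous_re)

/-- The Laplace transform of `1 / √(1 + ξ²)` solves an inhomogeneous Bessel equation. -/
theorem laplaceMoment_bessel_equation {z : ℂ} (hz : 0 < z.re) :
    z * laplaceMoment 2 z + laplaceMoment 1 z + z * laplaceMoment 0 z = 1 := by
  set e : ℕ → ℝ → ℂ := fun l ξ => (-(ξ : ℂ)) ^ l * Complex.exp (-z * ξ) *
    ((Real.sqrt (1 + ξ ^ 2))⁻¹ : ℝ) with he
  have hi : ∀ l, IntegrableOn (e l) (Ioi 0) := fun l => integrableOn_laplaceMoment l hz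
  have hpos : ∀ ξ : ℝ, 0 < Real.sqrt (1 + ξ ^ 2) := fun ξ => Real.sqrt_pos.mpr (by positivity)
  have hsq : ∀ ξ : ℝ, (Real.sqrt (1 + ξ ^ 2) : ℂ) =
      (1 + (ξ : ℂ) ^ 2) * ((Real.sqrt (1 + ξ ^ 2))⁻¹ : ℝ) := by
    intro ξ
    have : Real.sqrt (1 + ξ ^ 2) = (1 + ξ ^ 2) * (Real.sqrt (1 + ξ ^ 2))⁻¹ := by
      rw [← div_eq_mul_inv, Real.div_sqrt]
    exact_mod_cast congrArg (fun r : ℝ => (r : ℂ)) this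
  -- An antiderivative of the combined integrand `(zξ² - ξ + z) e^{-zξ} / √(1 + ξ²)`. It runs from
  -- `-1` at `0` to `0` at infinity, whence the right-hand side `1`.
  set f : ℝ → ℂ := fun ξ => -((Real.sqrt (1 + ξ ^ 2) : ℂ) * Complex.exp (-z * ξ)) with hf
  have hfe : f = fun ξ => -(e 2 ξ + e 0 ξ) := by
    ext ξ
    simp only [hf, he, hsq ξ]
    ring
  have hderiv : ∀ ξ : ℝ, HasDerivAt f (z * e 2 ξ + e 1 ξ + z * e 0 ξ) ξ := by
    intro ξ
    have h1 : HasDerivAt (fun ξ : ℝ => Real.sqrt (1 + ξ ^ 2))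
        (2 * ξ / (2 * Real.sqrt (1 + ξ ^ 2))) ξ := by
      have : HasDerivAt (fun ξ : ℝ => 1 + ξ ^ 2) (2 * ξ) ξ := by
        simpa using (hasDerivAt_pow 2 ξ).const_add 1
      exact this.sqrt (by positivity)
    have h2 : HasDerivAt (fun ξ : ℝ => Complex.exp (-z * ξ)) (Complex.exp (-z * ξ) * (-z * 1)) ξ :=
      ((Complex.ofRealCLM.hasDerivAt (x := ξ)).const_mul (-z)).cexp
    refine (h1.ofReal_comp.mul h2).neg.congr_deriv ?_
    simp only [he]
    rw [hsq ξ, show 2 * ξ / (2 * Real.sqrt (1 + ξ ^ 2)) = ξ * (Real.sqrt (1 + ξ ^ 2))⁻¹ by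
      have := (hpos ξ).ne'
      field_simp]
    push_cast
    ring
  have hint : IntegrableOn (fun ξ => z * e 2 ξ + e 1 ξ + z * e 0 ξ) (Ioi 0) :=
    (((hi 2).const_mul z).add (hi 1)).add ((hi 0).const_mul z)
  have hfint : IntegrableOn f (Ioi 0) := by
    rw [hfe]
    exact ((hi 2).add (hi 0)).neg
  have htend : Tendsto f atTop (𝓝 0) :=
    tendsto_zero_of_hasDerivAt_of_integrableOn_Ioi (fun ξ _ => hderiv ξ) hint hfint
  have h := integral_Ioi_of_hasDerivAt_of_tendsto (hderiv 0).continuousAt.continuousWithinAt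
    (fun ξ _ => hderiv ξ) hint htend
  have hint' : IntegrableOn (fun ξ => z * e 2 ξ + e 1 ξ) (Ioi 0) := ((hi 2).const_mul z).add (hi 1)
  rw [integral_add hint' ((hi 0).const_mul z),
    integral_add ((hi 2).const_mul z) (hi 1), integral_const_mul, integral_const_mul] at h
  rw [show f 0 = -1 by simp [hf], zero_sub, neg_neg] at h
  exact h

theorem laplaceMoment_ofReal (l : ℕ) (t : ℝ) : laplaceMoment l t =
    ((∫ ξ : ℝ in Ioi 0, (-ξ) ^ l * Real.exp (-t * ξ) * (Real.sqrt (1 + ξ ^ 2))⁻¹ : ℝ) : ℂ) := by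
  rw [laplaceMoment, ← integral_complex_ofReal]
  push_cast
  rfl

/-! ### Asymptotics of the Laplace transform at the origin -/

theorem tendsto_mul_inv_sqrt_one_add_sq_atTop :
    Tendsto (fun s : ℝ => s * (Real.sqrt (1 + s ^ 2))⁻¹) atTop (𝓝 1) := by
  have h : Tendsto (fun s : ℝ => (Real.sqrt (1 + (s ^ 2)⁻¹))⁻¹) atTop (𝓝 1) := by
    have h1 : Tendsto (fun s : ℝ => 1 + (s ^ 2)⁻¹) atTop (𝓝 (1 + 0)) :=
      (tendsto_inv_atTop_zero.comp (tendsto_pow_atTop two_ne_zero)).const_add 1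
    have h2 := (h1.sqrt).inv₀ (by simp)
    simpa using h2
  refine h.congr' ?_
  filter_upwards [eventually_gt_atTop 0] with s hs
  have h3 : Real.sqrt (1 + s ^ 2) = s * Real.sqrt (1 + (s ^ 2)⁻¹) := by
    rw [← Real.sqrt_sq hs.le, ← Real.sqrt_mul (sq_nonneg _), Real.sqrt_sq hs.le]
    congr 1
    field_simp
    ring
  rw [h3, mul_inv, ← mul_assoc, mul_inv_cancel₀ hs.ne', one_mul]

theorem mul_inv_sqrt_one_add_sq_le_one {s : ℝ} : s * (Real.sqrt (1 + s ^ 2))⁻¹ ≤ 1 := by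
  have hpos : 0 < Real.sqrt (1 + s ^ 2) := Real.sqrt_pos.mpr (by positivity)
  rw [← div_eq_mul_inv, div_le_one hpos]
  exact Real.le_sqrt_of_sq_le (by linarith)

/-- After `u = tξ` the integrand is `-e^{-u}` times `s / √(1 + s²)` with `s = u / t`, a factor
bounded by `1` and tending to `1`; dominated convergence applies. -/
theorem tendsto_mul_laplaceMoment_one :
    Tendsto (fun t : ℝ => (t : ℂ) * laplaceMoment 1 t) (𝓝[>] 0) (𝓝 (-1)) := by
  have h : Tendsto (fun t : ℝ => ∫ u : ℝ in Ioi 0,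
      -(u / t * (Real.sqrt (1 + (u / t) ^ 2))⁻¹) * Real.exp (-u)) (𝓝[>] 0)
      (𝓝 (∫ u : ℝ in Ioi 0, -1 * Real.exp (-u))) := by
    refine tendsto_integral_filter_of_dominated_convergence (fun u => Real.exp (-u)) ?_ ?_
      (integrableOn_exp_neg_Ioi 0) ?_
    · refine Eventually.of_forall fun t => Continuous.aestronglyMeasurable ?_
      have : Continuous fun u : ℝ => (Real.sqrt (1 + (u / t) ^ 2))⁻¹ :=
        Continuous.inv₀ (by fun_prop) fun ξ => (Real.sqrt_pos.mpr (by positivity)).ne'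
      fun_prop
    · filter_upwards [self_mem_nhdsWithin] with t ht
      refine (ae_restrict_iff' measurableSet_Ioi).mpr (ae_of_all _ fun u hu => ?_)
      have ht : 0 < t := ht
      have hu : 0 < u := hu
      rw [norm_mul, norm_neg, Real.norm_of_nonneg (Real.exp_pos _).le,
        Real.norm_of_nonneg (by positivity)]
      exact mul_le_of_le_one_left (Real.exp_pos _).le mul_inv_sqrt_one_add_sq_le_one
    · refine (ae_restrict_iff' measurableSet_Ioi).mpr (ae_of_all _ fun u hu => ?_)
      have hu : 0 < u := hu
      have h1 : Tendsto (fun t : ℝ => u / t) (𝓝[>] 0) atTop :=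
        tendsto_inv_nhdsGT_zero.const_mul_atTop hu
      exact ((tendsto_mul_inv_sqrt_one_add_sq_atTop.comp h1).neg).mul_const _
  rw [integral_const_mul, integral_exp_neg_Ioi_zero, mul_one] at h
  have h' := (Complex.continuous_ofReal.tendsto _).comp h
  rw [Complex.ofReal_neg, Complex.ofReal_one] at h'
  refine h'.congr' ?_
  filter_upwards [self_mem_nhdsWithin] with t ht
  have ht : 0 < t := ht
  have hsub := integral_comp_mul_left_Ioi
    (fun u : ℝ => -(u / t * (Real.sqrt (1 + (u / t) ^ 2))⁻¹) * Real.exp (-u)) 0 ht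
  rw [laplaceMoment_ofReal, ← Complex.ofReal_mul, Function.comp_apply]
  congr 1
  rw [mul_zero, smul_eq_mul] at hsub
  rw [← mul_inv_cancel_left₀ ht.ne' (∫ u : ℝ in Ioi 0,
    -(u / t * (Real.sqrt (1 + (u / t) ^ 2))⁻¹) * Real.exp (-u)), ← hsub]
  congr 1
  refine integral_congr_ae (ae_of_all _ fun ξ => ?_)
  simp only [mul_div_cancel_left₀ ξ ht.ne', pow_one, neg_mul]
  ring

/-- A majorant uniform in `t`. The upper bound uses `√(t² + u²) ≤ 1 + u`; the lower one applies `log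
r ≤ r - 1` to `r = u^(-1/2)`, a singularity integrable at `0`. -/
theorem abs_log_add_sqrt_le {t u : ℝ} (ht : 0 < t) (ht1 : t ≤ 1) (hu : 0 < u) :
    |Real.log (u + Real.sqrt (t ^ 2 + u ^ 2))| ≤ 2 * u + 2 * u ^ (-(1 / 2) : ℝ) := by
  have hs : 0 ≤ Real.sqrt (t ^ 2 + u ^ 2) := Real.sqrt_nonneg _
  have hs1 : Real.sqrt (t ^ 2 + u ^ 2) ≤ 1 + u := by
    rw [Real.sqrt_le_left (by positivity)]
    nlinarith
  have hr : 0 < u ^ (-(1 / 2) : ℝ) := Real.rpow_pos_of_pos hu _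
  rw [abs_le]
  constructor
  · have h1 : Real.log u ≤ Real.log (u + Real.sqrt (t ^ 2 + u ^ 2)) :=
      Real.log_le_log hu (by linarith)
    have h2 := Real.log_le_sub_one_of_pos hr
    rw [Real.log_rpow hu] at h2
    linarith
  · have := Real.log_le_sub_one_of_pos (show 0 < u + Real.sqrt (t ^ 2 + u ^ 2) by linarith)
    linarith

theorem integrableOn_exp_neg_mul_add_rpow : IntegrableOn
    (fun u : ℝ => Real.exp (-u) * (2 * u + 2 * u ^ (-(1 / 2) : ℝ))) (Ioi 0) := by
  have h1 := (Real.GammaIntegral_convergent (s := 2) two_pos).const_mul 2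
  have h2 := (Real.GammaIntegral_convergent (s := 1 / 2) (by norm_num)).const_mul 2
  refine (h1.add h2).congr (ae_of_all _ fun u => ?_)
  norm_num
  ring

theorem integrableOn_log_mul_exp_neg :
    IntegrableOn (fun u : ℝ => Real.exp (-u) * Real.log u) (Ioi 0) := by
  refine integrableOn_exp_neg_mul_add_rpow.mono'
    (Real.measurable_exp.comp measurable_neg |>.mul Real.measurable_log).aestronglyMeasurable ?_
  refine (ae_restrict_iff' measurableSet_Ioi).mpr (ae_of_all _ fun u hu => ?_)
  have hu : 0 < u := hu
  have hr : 0 < u ^ (-(1 / 2) : ℝ) := Real.rpow_pos_of_pos hu _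
  rw [norm_mul, Real.norm_of_nonneg (Real.exp_pos _).le, Real.norm_eq_abs]
  refine mul_le_mul_of_nonneg_left (abs_le.mpr ⟨?_, ?_⟩) (Real.exp_pos _).le
  · have h2 := Real.log_le_sub_one_of_pos hr
    rw [Real.log_rpow hu] at h2
    linarith
  · have := Real.log_le_sub_one_of_pos hu
    linarith

/-- Differentiation of the Gamma integral under the integral sign gives `Γ'(1)`, which is `-γ`. -/
theorem integral_exp_neg_mul_log :
    ∫ u : ℝ in Ioi 0, Real.exp (-u) * Real.log u = -Real.eulerMascheroniConstant := by
  have h1 : HasDerivAt Complex.Gamma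
      (∫ t : ℝ in Ioi 0, (t : ℂ) ^ ((1 : ℂ) - 1) * (Real.log t * Real.exp (-t))) 1 := by
    refine (Complex.hasDerivAt_GammaIntegral (s := 1) (by simp)).congr_of_eventuallyEq ?_
    filter_upwards [(isOpen_lt continuous_const Complex.continuous_re).mem_nhds
      (show (0 : ℝ) < (1 : ℂ).re by simp)] with s hs using Complex.Gamma_eq_integral hs
  have h2 := h1.unique Complex.hasDerivAt_Gamma_one
  apply Complex.ofReal_injective
  rw [← integral_complex_ofReal, Complex.ofReal_neg, ← h2]
  refine integral_congr_ae (ae_of_all _ fun u => ?_)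
  simp [mul_comm]

/-- This absorbs the logarithmic divergence: the right-hand side has the finite limit `log (2u)` as
`t → 0`. -/
theorem arsinh_div_add_log {t u : ℝ} (ht : 0 < t) (hu : 0 < u) :
    Real.arsinh (u / t) + Real.log t = Real.log (u + Real.sqrt (t ^ 2 + u ^ 2)) := by
  rw [Real.arsinh, ← Real.log_mul (by positivity) ht.ne']
  congr 1
  have h : Real.sqrt (t ^ 2 + u ^ 2) = Real.sqrt (1 + (u / t) ^ 2) * t := by
    rw [← Real.sqrt_sq ht.le, ← Real.sqrt_mul (by positivity), Real.sqrt_sq ht.le]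
    congr 1
    field_simp
  rw [h]
  field_simp

theorem arsinh_le_self {s : ℝ} (hs : 0 ≤ s) : Real.arsinh s ≤ s := by
  have h := Real.self_le_sinh_iff.mpr (Real.arsinh_nonneg_iff.mpr hs)
  rwa [Real.sinh_arsinh] at h

theorem integrableOn_exp_neg_mul_arsinh {t : ℝ} (ht : 0 < t) :
    IntegrableOn (fun ξ : ℝ => Real.exp (-t * ξ) * Real.arsinh ξ) (Ioi 0) := by
  refine (integrableOn_pow_mul_exp_neg_mul 1 ht).mono'
    (Continuous.aestronglyMeasurable (Continuous.mul (by fun_prop) Real.continuous_arsinh)) ?_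
  refine (ae_restrict_iff' measurableSet_Ioi).mpr (ae_of_all _ fun u hu => ?_)
  have hu : 0 < u := hu
  rw [norm_mul, Real.norm_of_nonneg (Real.exp_pos _).le,
    Real.norm_of_nonneg (Real.arsinh_nonneg_iff.mpr hu.le), mul_comm, pow_one]
  exact mul_le_mul_of_nonneg_right (arsinh_le_self hu.le) (Real.exp_pos _).le

/-- Integration by parts with `arsinh' = 1 / √(1 + ξ²)`, whose boundary terms vanish, followed by `u
= tξ`. -/
theorem integral_exp_neg_mul_inv_sqrt {t : ℝ} (ht : 0 < t) :
    ∫ ξ : ℝ in Ioi 0, Real.exp (-t * ξ) * (Real.sqrt (1 + ξ ^ 2))⁻¹ =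
      ∫ u : ℝ in Ioi 0, Real.exp (-u) * Real.arsinh (u / t) := by
  have hi1 : IntegrableOn (fun ξ : ℝ => Real.exp (-t * ξ) * (Real.sqrt (1 + ξ ^ 2))⁻¹) (Ioi 0) := by
    refine (integrableOn_pow_mul_exp_neg_mul 0 ht).mono' ?_ ?_
    · have : Continuous fun u : ℝ => (Real.sqrt (1 + u ^ 2))⁻¹ :=
        Continuous.inv₀ (by fun_prop) fun ξ => (Real.sqrt_pos.mpr (by positivity)).ne'
      exact Continuous.aestronglyMeasurable (by fun_prop)
    · refine ae_of_all _ fun u => ?_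
      rw [Real.norm_of_nonneg (by positivity), pow_zero, one_mul]
      exact mul_le_of_le_one_right (Real.exp_pos _).le (inv_sqrt_one_add_sq_le_one u)
  have hi2 := integrableOn_exp_neg_mul_arsinh ht
  have hderiv : ∀ ξ : ℝ, HasDerivAt (fun ξ : ℝ => Real.exp (-t * ξ) * Real.arsinh ξ)
      (Real.exp (-t * ξ) * (Real.sqrt (1 + ξ ^ 2))⁻¹ -
        t * (Real.exp (-t * ξ) * Real.arsinh ξ)) ξ := by
    intro ξ
    have h1 : HasDerivAt (fun ξ : ℝ => Real.exp (-t * ξ)) (Real.exp (-t * ξ) * (-t * 1)) ξ :=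
      ((hasDerivAt_id ξ).const_mul (-t)).exp
    refine (h1.mul (Real.hasDerivAt_arsinh ξ)).congr_deriv ?_
    ring
  have hint := hi1.sub (hi2.const_mul t)
  have htend := tendsto_zero_of_hasDerivAt_of_integrableOn_Ioi (fun ξ _ => hderiv ξ) hint hi2
  have h := integral_Ioi_of_hasDerivAt_of_tendsto (hderiv 0).continuousAt.continuousWithinAt
    (fun ξ _ => hderiv ξ) hint htend
  rw [integral_sub hi1 (hi2.const_mul t), integral_const_mul, Real.arsinh_zero, mul_zero, sub_zero,
    sub_eq_zero] at h
  have hsub := integral_comp_mul_left_Ioi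
    (fun u : ℝ => Real.exp (-u) * Real.arsinh (u / t)) 0 ht
  rw [mul_zero, smul_eq_mul] at hsub
  rw [h, ← mul_inv_cancel_left₀ ht.ne'
    (∫ u : ℝ in Ioi 0, Real.exp (-u) * Real.arsinh (u / t)), ← hsub]
  simp only [mul_div_cancel_left₀ _ ht.ne', neg_mul]

/-- The left side is `∫ e^{-u} log (u + √(t² + u²)) du`, which converges by domination to `∫ e^{-u}
log (2u) du`. -/
theorem tendsto_laplaceMoment_zero_add_log :
    Tendsto (fun t : ℝ => laplaceMoment 0 t + (Real.log t : ℂ)) (𝓝[>] 0)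
      (𝓝 ((Real.log 2 - Real.eulerMascheroniConstant : ℝ) : ℂ)) := by
  have h : Tendsto (fun t : ℝ => ∫ u : ℝ in Ioi 0,
      Real.exp (-u) * Real.log (u + Real.sqrt (t ^ 2 + u ^ 2))) (𝓝[>] 0)
      (𝓝 (∫ u : ℝ in Ioi 0, Real.exp (-u) * (Real.log 2 + Real.log u))) := by
    refine tendsto_integral_filter_of_dominated_convergence _ ?_ ?_
      integrableOn_exp_neg_mul_add_rpow ?_
    · exact Eventually.of_forall fun t => Measurable.aestronglyMeasurable (by fun_prop)
    · filter_upwards [Ioc_mem_nhdsGT (zero_lt_one (α := ℝ))] with t ht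
      refine (ae_restrict_iff' measurableSet_Ioi).mpr (ae_of_all _ fun u hu => ?_)
      rw [norm_mul, Real.norm_of_nonneg (Real.exp_pos _).le, Real.norm_eq_abs]
      exact mul_le_mul_of_nonneg_left (abs_log_add_sqrt_le ht.1 ht.2 hu) (Real.exp_pos _).le
    · refine (ae_restrict_iff' measurableSet_Ioi).mpr (ae_of_all _ fun u hu => ?_)
      have hu : 0 < u := hu
      have h1 : ContinuousAt
          (fun t : ℝ => Real.exp (-u) * Real.log (u + Real.sqrt (t ^ 2 + u ^ 2))) 0 := by
        refine continuousAt_const.mul (ContinuousAt.log (by fun_prop) ?_)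
        positivity
      have h2 := h1.tendsto.mono_left (nhdsWithin_le_nhds (s := Ioi 0))
      have h3 : u + Real.sqrt (0 ^ 2 + u ^ 2) = 2 * u := by
        rw [zero_pow two_ne_zero, zero_add, Real.sqrt_sq hu.le]
        ring
      rwa [h3, Real.log_mul two_ne_zero hu.ne'] at h2
  have hval : ∫ u : ℝ in Ioi 0, Real.exp (-u) * (Real.log 2 + Real.log u) =
      Real.log 2 - Real.eulerMascheroniConstant := by
    simp_rw [mul_add]
    rw [integral_add ((integrableOn_exp_neg_Ioi 0).mul_const _) integrableOn_log_mul_exp_neg,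
      integral_mul_const, integral_exp_neg_Ioi_zero, integral_exp_neg_mul_log]
    ring
  rw [hval] at h
  refine ((Complex.continuous_ofReal.tendsto _).comp h).congr' ?_
  filter_upwards [self_mem_nhdsWithin] with t ht
  have ht : 0 < t := ht
  rw [laplaceMoment_ofReal, ← Complex.ofReal_add, Function.comp_apply]
  congr 1
  simp only [pow_zero, one_mul]
  have hint : IntegrableOn (fun u : ℝ => Real.exp (-u) * Real.arsinh (u / t)) (Ioi 0) := by
    have h := (integrableOn_Ioi_comp_mul_left_iff
      (fun u : ℝ => Real.exp (-u) * Real.arsinh (u / t)) 0 ht).mp (by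
        simpa only [mul_div_cancel_left₀ _ ht.ne', neg_mul] using
          integrableOn_exp_neg_mul_arsinh ht)
    simpa using h
  -- `log t` enters the integral through `∫ e^{-u} du = 1`.
  rw [integral_exp_neg_mul_inv_sqrt ht, ← one_mul (Real.log t), ← integral_exp_neg_Ioi_zero,
    ← integral_mul_const, ← integral_add hint ((integrableOn_exp_neg_Ioi 0).mul_const _)]
  refine setIntegral_congr_fun measurableSet_Ioi fun u hu => ?_
  rw [← mul_add, arsinh_div_add_log ht hu]

end SobolevLaguerre

namespace SobolevLaguerre

open Filter Topology

/-! ### Entire power series and the Euler operator -/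

section EntireSeries

/-- The sum of the power series with coefficients `c`. -/
noncomputable def seriesSum (c : ℕ → ℂ) (w : ℂ) : ℂ := ∑' k : ℕ, c k * w ^ k

/-- The coefficients `c` define an everywhere convergent power series. -/
def IsEntireCoeff (c : ℕ → ℂ) : Prop := ∀ r : ℝ, 0 ≤ r → Summable fun k => ‖c k‖ * r ^ k

variable {c d e : ℕ → ℂ}

theorem IsEntireCoeff.of_le {C R : ℝ} (h : ∀ k, ‖c k‖ ≤ C * R ^ k / k !) : IsEntireCoeff c := by
  intro r hr
  refine Summable.of_nonneg_of_le (fun k => by positivity) (fun k => ?_)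
    ((Real.summable_pow_div_factorial (R * r)).mul_left C)
  calc ‖c k‖ * r ^ k ≤ C * R ^ k / k ! * r ^ k := by gcongr; exact h k
    _ = C * ((R * r) ^ k / k !) := by rw [mul_pow]; ring

/-- The factor `k` is the Euler operator `w d/dw` on coefficients; since `k ≤ 2^k`, it costs only a
doubled radius. -/
theorem IsEntireCoeff.natCast_mul (hc : IsEntireCoeff c) :
    IsEntireCoeff fun k => (k : ℂ) * c k := by
  intro r hr
  refine Summable.of_nonneg_of_le (fun k => by positivity) (fun k => ?_)
    (hc (2 * r) (by positivity))
  rw [norm_mul, Complex.norm_natCast, mul_pow]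
  have h : (k : ℝ) ≤ 2 ^ k := by exact_mod_cast Nat.lt_two_pow_self.le
  calc (k : ℝ) * ‖c k‖ * r ^ k ≤ 2 ^ k * ‖c k‖ * r ^ k := by gcongr
    _ = _ := by ring

theorem IsEntireCoeff.add (hc : IsEntireCoeff c) (hd : IsEntireCoeff d) :
    IsEntireCoeff fun k => c k + d k := by
  intro r hr
  refine Summable.of_nonneg_of_le (fun k => by positivity) (fun k => ?_) ((hc r hr).add (hd r hr))
  rw [← add_mul]
  gcongr
  exact norm_add_le _ _

theorem IsEntireCoeff.const_mul (hc : IsEntireCoeff c) (a : ℂ) :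
    IsEntireCoeff fun k => a * c k := by
  intro r hr
  simpa only [norm_mul, mul_assoc] using (hc r hr).mul_left ‖a‖

theorem IsEntireCoeff.shift (hc : IsEntireCoeff c) : IsEntireCoeff fun k => c (k + 1) := by
  intro r hr
  have h := (summable_nat_add_iff 1).mpr (hc (max r 1) (by positivity))
  refine Summable.of_nonneg_of_le (fun k => by positivity) (fun k => ?_) h
  have h1 : r ^ k ≤ max r 1 ^ (k + 1) :=
    (pow_le_pow_left₀ hr (le_max_left r 1) k).trans
      (pow_le_pow_right₀ (le_max_right r 1) (Nat.le_succ k))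
  gcongr

theorem IsEntireCoeff.summable (hc : IsEntireCoeff c) (w : ℂ) : Summable fun k => c k * w ^ k :=
  Summable.of_norm (by simpa only [norm_mul, norm_pow] using hc ‖w‖ (norm_nonneg w))

theorem seriesSum_add (hc : IsEntireCoeff c) (hd : IsEntireCoeff d) (w : ℂ) :
    seriesSum (fun k => c k + d k) w = seriesSum c w + seriesSum d w := by
  simp only [seriesSum, add_mul]
  exact (hc.summable w).tsum_add (hd.summable w)

theorem seriesSum_const_mul (a : ℂ) (w : ℂ) :
    seriesSum (fun k => a * c k) w = a * seriesSum c w := by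
  simp only [seriesSum, mul_assoc, tsum_mul_left]

/-- Turns a two-term recurrence of coefficients into an identity of functions; the differential
equations below are read off from it. -/
theorem seriesSum_eq_zero_add_mul (hd : IsEntireCoeff d) {r : ℂ}
    (h : ∀ k, d (k + 1) = r * e k) (w : ℂ) :
    seriesSum d w = d 0 + r * w * seriesSum e w := by
  rw [seriesSum, (hd.summable w).tsum_eq_zero_add, pow_zero, mul_one, seriesSum, ← tsum_mul_left]
  congr 1
  exact tsum_congr fun k => by rw [h, pow_succ]; ring

theorem seriesSum_zero (c : ℕ → ℂ) : seriesSum c 0 = c 0 := by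
  rw [seriesSum, tsum_eq_single 0 fun k hk => by rw [zero_pow hk, mul_zero]]
  simp

theorem IsEntireCoeff.differentiableAt_and_mul_deriv (hc : IsEntireCoeff c) (w : ℂ) :
    DifferentiableAt ℂ (seriesSum c) w ∧
      w * deriv (seriesSum c) w = seriesSum (fun k => (k : ℂ) * c k) w := by
  set r : ℝ := ‖w‖ + 1
  have hr : 0 ≤ r := by positivity
  have hU : IsOpen (Metric.ball (0 : ℂ) r) := Metric.isOpen_ball
  have hw : w ∈ Metric.ball (0 : ℂ) r := by simp [r]
  have hdiff : ∀ k : ℕ, DifferentiableOn ℂ (fun y : ℂ => c k * y ^ k) (Metric.ball 0 r) :=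
    fun k => by fun_prop
  have hle : ∀ (k : ℕ) (y : ℂ), y ∈ Metric.ball (0 : ℂ) r → ‖c k * y ^ k‖ ≤ ‖c k‖ * r ^ k := by
    intro k y hy
    rw [norm_mul, norm_pow]
    have : ‖y‖ ≤ r := (mem_ball_zero_iff.mp hy).le
    gcongr
  refine ⟨(Complex.differentiableOn_tsum_of_summable_norm (hc r hr) hdiff hU hle).differentiableAt
    (hU.mem_nhds hw), ?_⟩
  have h := Complex.hasSum_deriv_of_summable_norm (hc r hr) hdiff hU hle hw
  have h' := h.mul_left w
  refine h'.tsum_eq.symm.trans (tsum_congr fun k => ?_)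
  rw [deriv_const_mul_field, deriv_pow_field]
  rcases k with _ | k
  · simp
  · rw [Nat.add_sub_cancel, pow_succ]
    ring

theorem IsEntireCoeff.continuous (hc : IsEntireCoeff c) : Continuous (seriesSum c) :=
  continuous_iff_continuousAt.mpr fun w => (hc.differentiableAt_and_mul_deriv w).1.continuousAt

/-- For `w = z² / 4` one has `z d/dz = 2 w d/dw`. -/
theorem IsEntireCoeff.hasDerivAt_comp_sq_div_four (hc : IsEntireCoeff c) {z : ℂ} (hz : z ≠ 0) :
    HasDerivAt (fun y : ℂ => seriesSum c (y ^ 2 / 4))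
      (2 * seriesSum (fun k => (k : ℂ) * c k) (z ^ 2 / 4) / z) z := by
  obtain ⟨hd, hm⟩ := hc.differentiableAt_and_mul_deriv (z ^ 2 / 4)
  have h1 : HasDerivAt (fun y : ℂ => y ^ 2 / 4) (2 * z / 4) z := by
    simpa using (hasDerivAt_pow 2 z).div_const 4
  refine (hd.hasDerivAt.comp z h1).congr_deriv ?_
  rw [← hm]
  field_simp

end EntireSeries

/-! ### The reciprocal Gamma function and its derivative at positive integers -/

section ReciprocalGamma

/-- The derivative of `1 / Γ` at `k + 1`. -/
noncomputable def rgammaDeriv (k : ℕ) : ℂ := deriv (fun s : ℂ => (Complex.Gamma s)⁻¹) (k + 1)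

theorem rgammaDeriv_zero : rgammaDeriv 0 = Real.eulerMascheroniConstant := by
  have h := Complex.hasDerivAt_Gamma_one.fun_inv (by simp)
  simp only [rgammaDeriv, Nat.cast_zero, zero_add]
  rw [h.deriv]
  simp

/-- Differentiate `1/Γ(s) = s/Γ(s+1)` at `s = k + 1`. -/
theorem rgammaDeriv_eq (k : ℕ) :
    rgammaDeriv k = ((k + 1) ! : ℂ)⁻¹ + (k + 1) * rgammaDeriv (k + 1) := by
  have h1 : HasDerivAt (fun s : ℂ => (Complex.Gamma (s + 1))⁻¹) (rgammaDeriv (k + 1)) (k + 1) := by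
    have h := (Complex.differentiable_one_div_Gamma ((k + 1 : ℂ) + 1)).hasDerivAt
    have h' := h.comp_add_const (k + 1 : ℂ) 1
    simpa only [rgammaDeriv, Nat.cast_add, Nat.cast_one] using h'
  have h2 : HasDerivAt (fun s : ℂ => (Complex.Gamma s)⁻¹)
      (1 * (Complex.Gamma ((k + 1 : ℂ) + 1))⁻¹ + (k + 1) * rgammaDeriv (k + 1)) (k + 1) := by
    rw [show (fun s : ℂ => (Complex.Gamma s)⁻¹) = fun s => s * (Complex.Gamma (s + 1))⁻¹ from
      funext Complex.one_div_Gamma_eq_self_mul_one_div_Gamma_add_one]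
    exact (hasDerivAt_id _).mul h1
  have h3 : Complex.Gamma ((k + 1 : ℂ) + 1) = (k + 1) ! := by
    exact_mod_cast Complex.Gamma_nat_eq_factorial (k + 1)
  rw [rgammaDeriv, h2.deriv, h3, one_mul]

theorem norm_rgammaDeriv_le (k : ℕ) : ‖rgammaDeriv k‖ ≤ ‖rgammaDeriv 0‖ + k := by
  induction k with
  | zero => simp
  | succ k ih =>
    have h : (k + 1 : ℂ) * rgammaDeriv (k + 1) = rgammaDeriv k - ((k + 1) ! : ℂ)⁻¹ := by
      rw [rgammaDeriv_eq k]
      ring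
    have h1 : ‖(k + 1 : ℂ)‖ = k + 1 := by exact_mod_cast Complex.norm_natCast (k + 1)
    have h2 : ‖((k + 1) ! : ℂ)⁻¹‖ ≤ 1 := by
      rw [norm_inv, Complex.norm_natCast]
      exact inv_le_one_of_one_le₀ (by exact_mod_cast Nat.factorial_pos (k + 1))
    have h3 : ‖rgammaDeriv (k + 1)‖ ≤ ‖(k + 1 : ℂ) * rgammaDeriv (k + 1)‖ := by
      rw [norm_mul, h1]
      exact le_mul_of_one_le_left (norm_nonneg _) (by linarith [k.cast_nonneg (α := ℝ)])
    rw [h] at h3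
    have h4 := norm_sub_le (rgammaDeriv k) ((k + 1) ! : ℂ)⁻¹
    push_cast
    linarith

/-- Compactness gives the case `k = 0`. Each further step divides by `ν + k + 1`, of modulus at
least `1/2`. Uniformity in `ν` is what differentiation of the Bessel series in its order needs. -/
theorem exists_norm_inv_Gamma_le : ∃ M : ℝ, 0 ≤ M ∧ ∀ (k : ℕ) (ν : ℂ), ‖ν‖ ≤ 1 / 2 →
    ‖(Complex.Gamma (ν + k + 1))⁻¹‖ ≤ M * 2 ^ k := by
  have hcont : Continuous fun ν : ℂ => (Complex.Gamma (ν + 1))⁻¹ :=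
    Complex.differentiable_one_div_Gamma.continuous.comp (continuous_add_const 1)
  obtain ⟨M, hM⟩ := (isCompact_closedBall (0 : ℂ) (1 / 2)).exists_bound_of_continuousOn
    hcont.continuousOn
  have h0 : 0 ≤ M := (norm_nonneg _).trans (hM 0 (by simp))
  refine ⟨M, h0, fun k ν hν => ?_⟩
  induction k with
  | zero => simpa using hM ν (by simpa using hν)
  | succ k ih =>
    rw [Complex.one_div_Gamma_eq_self_mul_one_div_Gamma_add_one, norm_mul] at ih
    have h1 : 1 / 2 ≤ ‖ν + k + 1‖ := by
      have h2 : ‖((k + 1 : ℕ) : ℂ)‖ ≤ ‖ν + k + 1‖ + ‖ν‖ := by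
        have := norm_sub_le (ν + k + 1) ν
        rwa [show ν + k + 1 - ν = ((k + 1 : ℕ) : ℂ) by push_cast; ring] at this
      rw [Complex.norm_natCast] at h2
      push_cast at h2
      linarith [k.cast_nonneg (α := ℝ)]
    have h3 : 1 / 2 * ‖(Complex.Gamma (ν + k + 1 + 1))⁻¹‖ ≤ M * 2 ^ k :=
      (mul_le_mul_of_nonneg_right h1 (norm_nonneg _)).trans ih
    push_cast
    rw [pow_succ, ← add_assoc]
    linarith

end ReciprocalGamma

/-! ### Series and differential equations for `J_0`, `Y_0` and `H_0` -/

section SpecialFunctions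

/-- The coefficients of `J_0` in the variable `z² / 4`. -/
noncomputable def besselCoeff (k : ℕ) : ℂ := (-1) ^ k * ((k ! : ℂ) * (k ! : ℂ))⁻¹

/-- The coefficients of the regular part of `(π / 2) Y_0` in the variable `z² / 4`. -/
noncomputable def weberCoeff (k : ℕ) : ℂ := (-1) ^ k * (k ! : ℂ)⁻¹ * rgammaDeriv k

/-- The coefficients of `H_0(z) / (z / 2)` in the variable `z² / 4`. -/
noncomputable def struveCoeff (k : ℕ) : ℂ :=
  (-1) ^ k * (Complex.Gamma (k + 3 / 2) * Complex.Gamma (k + 3 / 2))⁻¹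

theorem isEntireCoeff_besselCoeff : IsEntireCoeff besselCoeff := by
  refine IsEntireCoeff.of_le (C := 1) (R := 1) fun k => ?_
  rw [besselCoeff, norm_mul, norm_pow, norm_neg, norm_one, one_pow, one_mul, one_mul,
    norm_inv, norm_mul, Complex.norm_natCast, one_div]
  have h : (1 : ℝ) ≤ k ! := by exact_mod_cast Nat.factorial_pos k
  gcongr
  exact le_mul_of_one_le_left (by positivity) h

theorem isEntireCoeff_weberCoeff : IsEntireCoeff weberCoeff := by
  refine IsEntireCoeff.of_le (C := ‖rgammaDeriv 0‖ + 1) (R := 2) fun k => ?_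
  rw [weberCoeff, norm_mul, norm_mul, norm_pow, norm_neg, norm_one, one_pow, one_mul,
    norm_inv, Complex.norm_natCast, mul_comm, ← div_eq_mul_inv]
  have h1 : (k : ℝ) ≤ 2 ^ k := by exact_mod_cast Nat.lt_two_pow_self.le
  have h2 : (1 : ℝ) ≤ 2 ^ k := one_le_pow₀ (by norm_num)
  gcongr
  calc ‖rgammaDeriv k‖ ≤ ‖rgammaDeriv 0‖ + k := norm_rgammaDeriv_le k
    _ ≤ ‖rgammaDeriv 0‖ * 2 ^ k + 1 * 2 ^ k := by
      gcongr
      · exact le_mul_of_one_le_right (norm_nonneg _) h2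
      · linarith
    _ = _ := by ring

theorem natCast_add_three_halves_ne_zero (k : ℕ) : (k + 3 / 2 : ℂ) ≠ 0 := by
  have h : ((k + 3 / 2 : ℝ) : ℂ) ≠ 0 := Complex.ofReal_ne_zero.mpr (by positivity)
  push_cast at h
  exact h

theorem struveCoeff_succ (k : ℕ) :
    struveCoeff (k + 1) = -struveCoeff k / ((k + 3 / 2) * (k + 3 / 2)) := by
  have h := Complex.Gamma_add_one _ (natCast_add_three_halves_ne_zero k)
  rw [struveCoeff, struveCoeff, Nat.cast_add, Nat.cast_one, add_right_comm, h, pow_succ]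
  simp only [mul_inv, div_eq_mul_inv]
  ring

theorem struveCoeff_zero : struveCoeff 0 = 4 / Real.pi := by
  have h1 : Complex.Gamma (3 / 2) = 1 / 2 * (Real.sqrt Real.pi : ℂ) := by
    have h := Complex.Gamma_add_one (1 / 2) (by norm_num)
    rw [Complex.Gamma_one_half_eq, show (1 / 2 + 1 : ℂ) = 3 / 2 by norm_num] at h
    rw [h, Real.sqrt_eq_rpow, Complex.ofReal_cpow Real.pi_pos.le]
    norm_num
  have h2 : (Real.sqrt Real.pi : ℂ) * (Real.sqrt Real.pi : ℂ) = Real.pi := by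
    rw [← Complex.ofReal_mul, Real.mul_self_sqrt Real.pi_pos.le]
  rw [struveCoeff, Nat.cast_zero, zero_add, h1, pow_zero, one_mul,
    show 1 / 2 * (Real.sqrt Real.pi : ℂ) * (1 / 2 * (Real.sqrt Real.pi : ℂ)) =
      1 / 4 * ((Real.sqrt Real.pi : ℂ) * (Real.sqrt Real.pi : ℂ)) by ring, h2]
  have : (Real.pi : ℂ) ≠ 0 := Complex.ofReal_ne_zero.mpr Real.pi_ne_zero
  field_simp

theorem isEntireCoeff_struveCoeff : IsEntireCoeff struveCoeff := by
  refine IsEntireCoeff.of_le (C := ‖struveCoeff 0‖) (R := 1) fun k => ?_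
  rw [one_pow, mul_one]
  induction k with
  | zero => simp
  | succ k ih =>
    have h : ‖(k + 3 / 2 : ℂ)‖ = k + 3 / 2 := by
      rw [show (k + 3 / 2 : ℂ) = ((k + 3 / 2 : ℝ) : ℂ) by push_cast; rfl, Complex.norm_real,
        Real.norm_of_nonneg (by positivity)]
    rw [struveCoeff_succ, norm_div, norm_neg, norm_mul, h, Nat.factorial_succ, Nat.cast_mul,
      mul_comm ((k + 1 : ℕ) : ℝ), ← div_div (‖struveCoeff 0‖)]
    have h2 : ((k + 1 : ℕ) : ℝ) ≤ (k + 3 / 2) * (k + 3 / 2) := by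
      push_cast
      nlinarith [k.cast_nonneg (α := ℝ)]
    gcongr

/-- The recurrence `(k + 1)² c_{k+1} = -c_k`, which is Bessel's equation in the variable `w = z² /
4`. -/
theorem seriesSum_bessel_equation (w : ℂ) :
    seriesSum (fun k => (k : ℂ) * (k * besselCoeff k)) w = -w * seriesSum besselCoeff w := by
  rw [seriesSum_eq_zero_add_mul isEntireCoeff_besselCoeff.natCast_mul.natCast_mul (e := besselCoeff)
    (r := -1)]
  · simp
  · intro k
    have h1 : (k ! : ℂ) ≠ 0 := by exact_mod_cast Nat.factorial_ne_zero k
    have h2 : (k + 1 : ℂ) ≠ 0 := by exact_mod_cast Nat.succ_ne_zero k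
    rw [besselCoeff, besselCoeff, Nat.factorial_succ]
    push_cast
    rw [pow_succ]
    field_simp

/-- The first sum is the cross term left when `(w d/dw)²` acts on `log (z/2) · J_0`. The
coefficients match by `rgammaDeriv_eq`. -/
theorem seriesSum_weber_equation (w : ℂ) :
    seriesSum (fun k => (k : ℂ) * besselCoeff k) w +
      seriesSum (fun k => (k : ℂ) * (k * weberCoeff k)) w = -w * seriesSum weberCoeff w := by
  have hA := isEntireCoeff_besselCoeff.natCast_mul
  have hB := isEntireCoeff_weberCoeff.natCast_mul.natCast_mul
  rw [← seriesSum_add hA hB, seriesSum_eq_zero_add_mul (hA.add hB) (e := weberCoeff) (r := -1)]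
  · simp
  · intro k
    have h1 : (k ! : ℂ) ≠ 0 := by exact_mod_cast Nat.factorial_ne_zero k
    have h2 : (k + 1 : ℂ) ≠ 0 := by exact_mod_cast Nat.succ_ne_zero k
    have h3 : rgammaDeriv k = ((k + 1) ! : ℂ)⁻¹ + (k + 1) * rgammaDeriv (k + 1) := rgammaDeriv_eq k
    rw [besselCoeff, weberCoeff, weberCoeff, h3, Nat.factorial_succ]
    push_cast
    rw [pow_succ]
    field_simp
    ring

/-- The prefactor `z` shifts the Euler exponent to `2k + 1`, and `1 + 4k + 4k² = (2k + 1)²` matches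
the recurrence of the coefficients. The inhomogeneity is the term `k = 0`. -/
theorem seriesSum_struve_equation (w : ℂ) :
    seriesSum struveCoeff w + 4 * seriesSum (fun k => (k : ℂ) * struveCoeff k) w +
      4 * seriesSum (fun k => (k : ℂ) * (k * struveCoeff k)) w =
        4 / Real.pi - 4 * w * seriesSum struveCoeff w := by
  have h0 := isEntireCoeff_struveCoeff
  have h1 := h0.natCast_mul.const_mul 4
  have h2 := h0.natCast_mul.natCast_mul.const_mul 4
  rw [← seriesSum_const_mul, ← seriesSum_const_mul, ← seriesSum_add h0 h1,
    ← seriesSum_add (h0.add h1) h2, seriesSum_eq_zero_add_mul ((h0.add h1).add h2)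
      (e := struveCoeff) (r := -4)]
  · rw [struveCoeff_zero]
    push_cast
    ring
  · intro k
    have h := natCast_add_three_halves_ne_zero k
    rw [struveCoeff_succ]
    push_cast
    obtain ⟨y, hy⟩ : ∃ y : ℂ, y = k + 3 / 2 := ⟨_, rfl⟩
    rw [← hy, show (k : ℂ) = y - 3 / 2 by rw [hy]; ring]
    rw [← hy] at h
    field_simp
    ring

theorem struveH_zero_eq (z : ℂ) :
    struveH 0 z = z / 2 * seriesSum struveCoeff (z ^ 2 / 4) := by
  rw [struveH, zero_add, Complex.cpow_one, seriesSum]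
  congr 1
  refine tsum_congr fun k => ?_
  rw [struveCoeff, add_zero, pow_mul, div_pow, show (2 : ℂ) ^ 2 = 4 by norm_num]
  ring

/-- The series is differentiated termwise in the order `ν`, by locally uniform convergence of
holomorphic terms; the prefactor `(z/2)^ν` contributes the logarithm. -/
theorem hasDerivAt_besselJ_order_zero {z : ℂ} (hz : z ≠ 0) :
    HasDerivAt (fun ν : ℂ => besselJ ν z)
      (Complex.log (z / 2) * seriesSum besselCoeff (z ^ 2 / 4) +
        seriesSum weberCoeff (z ^ 2 / 4)) 0 := by
  obtain ⟨M, hM0, hM⟩ := exists_norm_inv_Gamma_le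
  set w : ℂ := z ^ 2 / 4
  set f : ℕ → ℂ → ℂ := fun k ν =>
    (-1) ^ k * w ^ k * ((k ! : ℂ) * Complex.Gamma (ν + k + 1))⁻¹ with hf
  have hfd : ∀ k ν, HasDerivAt (f k) ((-1) ^ k * w ^ k * ((k ! : ℂ)⁻¹ *
      deriv (fun s : ℂ => (Complex.Gamma s)⁻¹) (ν + (k + 1)))) ν := by
    intro k ν
    have h := (Complex.differentiable_one_div_Gamma (ν + (k + 1))).hasDerivAt.comp_add_const ν
      (k + 1 : ℂ)
    have h' := (h.const_mul ((k ! : ℂ)⁻¹)).const_mul ((-1) ^ k * w ^ k)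
    simpa only [hf, mul_inv, add_assoc] using h'
  have hU : IsOpen (Metric.ball (0 : ℂ) (1 / 2)) := Metric.isOpen_ball
  have h0 : (0 : ℂ) ∈ Metric.ball (0 : ℂ) (1 / 2) := by simp
  have hdiff : ∀ k, DifferentiableOn ℂ (f k) (Metric.ball 0 (1 / 2)) :=
    fun k ν _ => (hfd k ν).differentiableAt.differentiableWithinAt
  have hsum : Summable fun k : ℕ => M * ((2 * ‖w‖) ^ k / k !) :=
    (Real.summable_pow_div_factorial _).mul_left M
  have hle : ∀ (k : ℕ) (ν : ℂ), ν ∈ Metric.ball (0 : ℂ) (1 / 2) →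
      ‖f k ν‖ ≤ M * ((2 * ‖w‖) ^ k / k !) := by
    intro k ν hν
    have h := hM k ν (mem_ball_zero_iff.mp hν).le
    simp only [hf, mul_inv, norm_mul, norm_pow, norm_neg, norm_one, one_pow, one_mul]
    rw [norm_inv (k ! : ℂ), Complex.norm_natCast]
    calc ‖w‖ ^ k * ((k ! : ℝ)⁻¹ * ‖(Complex.Gamma (ν + k + 1))⁻¹‖)
        ≤ ‖w‖ ^ k * ((k ! : ℝ)⁻¹ * (M * 2 ^ k)) := by gcongr
      _ = _ := by rw [mul_pow]; ring
  have hS : HasDerivAt (fun ν => ∑' k, f k ν) (seriesSum weberCoeff w) 0 := by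
    have hd := (Complex.differentiableOn_tsum_of_summable_norm hsum hdiff hU hle).differentiableAt
      (hU.mem_nhds h0)
    have hs := Complex.hasSum_deriv_of_summable_norm hsum hdiff hU hle h0
    refine hd.hasDerivAt.congr_deriv (hs.tsum_eq.symm.trans (tsum_congr fun k => ?_))
    rw [(hfd k 0).deriv, zero_add, weberCoeff, rgammaDeriv]
    ring
  have hS0 : ∑' k, f k 0 = seriesSum besselCoeff w := by
    refine tsum_congr fun k => ?_
    simp only [hf, besselCoeff, zero_add, Complex.Gamma_nat_eq_factorial]
    ring
  have hz2 : z / 2 ≠ 0 := div_ne_zero hz two_ne_zero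
  have hpow : HasDerivAt (fun ν : ℂ => (z / 2) ^ ν) ((z / 2) ^ (0 : ℂ) * Complex.log (z / 2) * 1) 0 :=
    (hasDerivAt_id (0 : ℂ)).const_cpow (Or.inl hz2)
  refine (hpow.mul hS).congr_deriv ?_
  rw [hS0, Complex.cpow_zero]
  ring

theorem half_pi_mul_weberStruve {z : ℂ} (hz : z ≠ 0) :
    Real.pi / 2 * weberStruve z =
      Complex.log (z / 2) * seriesSum besselCoeff (z ^ 2 / 4) + seriesSum weberCoeff (z ^ 2 / 4) -
        Real.pi / 4 * z * seriesSum struveCoeff (z ^ 2 / 4) := by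
  have hpi : (Real.pi : ℂ) ≠ 0 := Complex.ofReal_ne_zero.mpr Real.pi_ne_zero
  rw [weberStruve, besselY, struveH_zero_eq]
  -- At order `0` the two order derivatives in `besselY` coincide.
  simp only [Int.cast_zero, neg_zero, zpow_zero, (hasDerivAt_besselJ_order_zero hz).deriv]
  field_simp
  ring

end SpecialFunctions

end SobolevLaguerre

/-! ### Uniqueness for the Bessel equation at its singular point -/

namespace SobolevLaguerre

open MeasureTheory Set Filter Topology

/-- A bound on the derivative passes to the function if that tends to `0` at the left endpoint. -/
theorem norm_le_mul_of_tendsto_zero {f f' : ℝ → ℂ} {δ K : ℝ}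
    (hf : ∀ t ∈ Ioo 0 δ, HasDerivAt f (f' t) t) (hK : ∀ t ∈ Ioo 0 δ, ‖f' t‖ ≤ K)
    (h0 : Tendsto f (𝓝[>] 0) (𝓝 0)) {t : ℝ} (ht : t ∈ Ioo 0 δ) : ‖f t‖ ≤ K * t := by
  have h1 : Tendsto (fun s => ‖f t - f s‖) (𝓝[>] 0) (𝓝 ‖f t - 0‖) :=
    (tendsto_const_nhds.sub h0).norm
  have h2 : Tendsto (fun s : ℝ => K * ‖t - s‖) (𝓝[>] 0) (𝓝 (K * ‖t - 0‖)) :=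
    Tendsto.mono_left (Continuous.tendsto (by fun_prop) 0) nhdsWithin_le_nhds
  have h3 : ∀ᶠ s in 𝓝[>] (0 : ℝ), ‖f t - f s‖ ≤ K * ‖t - s‖ := by
    filter_upwards [Ioo_mem_nhdsGT (ht.1.trans ht.2)] with s hs
    exact (convex_Ioo 0 δ).norm_image_sub_le_of_norm_hasDerivWithin_le
      (fun x hx => (hf x hx).hasDerivWithinAt) hK hs ht
  have h4 := le_of_tendsto_of_tendsto h1 h2 h3
  rwa [sub_zero, sub_zero, Real.norm_of_nonneg ht.1.le] at h4

/-- The Bessel equation of order `0`, as the system `t D' = E`, `E' = -t D`, has no nonzero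
solution with `D` and `E` vanishing at the origin. -/
theorem eventually_eq_zero_of_bessel_system {D E : ℝ → ℂ}
    (hD : ∀ t, 0 < t → HasDerivAt D (E t / t) t) (hE : ∀ t, 0 < t → HasDerivAt E (-t * D t) t)
    (hD0 : Tendsto D (𝓝[>] 0) (𝓝 0)) (hE0 : Tendsto E (𝓝[>] 0) (𝓝 0)) :
    ∀ᶠ t in 𝓝[>] (0 : ℝ), D t = 0 := by
  have h1 : ∀ᶠ t in 𝓝[>] (0 : ℝ), ‖D t‖ < 1 :=
    (tendsto_zero_iff_norm_tendsto_zero.mp hD0).eventually_lt_const one_pos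
  obtain ⟨ε, hε, hsub⟩ := mem_nhdsGT_iff_exists_Ioo_subset.mp h1
  have hε : 0 < ε := hε
  set δ := min ε (1 / 2)
  have hδ : 0 < δ := lt_min hε (by norm_num)
  have hδ2 : δ ≤ 1 / 2 := min_le_right _ _
  -- One round through the system halves the bound: `‖D‖ ≤ 2^{-n}` gives `‖E‖ ≤ 2^{-n} t`, hence
  -- `‖D'‖ ≤ 2^{-n}` and `‖D‖ ≤ 2^{-n} t`, with `t < 1/2`.
  have key : ∀ n : ℕ, ∀ t ∈ Ioo 0 δ, ‖D t‖ ≤ (1 / 2) ^ n := by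
    intro n
    induction n with
    | zero =>
      intro t ht
      simpa using le_of_lt (hsub ⟨ht.1, ht.2.trans_le (min_le_left _ _)⟩)
    | succ n ih =>
      have hEle : ∀ t ∈ Ioo 0 δ, ‖E t‖ ≤ (1 / 2) ^ n * t := by
        intro t ht
        refine norm_le_mul_of_tendsto_zero (fun s hs => hE s hs.1) (fun s hs => ?_) hE0 ht
        rw [norm_mul, norm_neg, Complex.norm_real, Real.norm_of_nonneg hs.1.le]
        refine (mul_le_of_le_one_left (norm_nonneg _) ?_).trans (ih s hs)
        linarith [hs.2]
      intro t ht
      have h := norm_le_mul_of_tendsto_zero (K := (1 / 2) ^ n) (fun s hs => hD s hs.1)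
        (fun s hs => ?_) hD0 ht
      · refine h.trans ?_
        rw [pow_succ]
        gcongr
        exact ht.2.le.trans hδ2
      · rw [norm_div, Complex.norm_real, Real.norm_of_nonneg hs.1.le, div_le_iff₀ hs.1]
        exact hEle s hs
  filter_upwards [Ioo_mem_nhdsGT hδ] with t ht
  have hlim : Tendsto (fun n : ℕ => (1 / 2 : ℝ) ^ n) atTop (𝓝 0) :=
    tendsto_pow_atTop_nhds_zero_of_lt_one (by norm_num) (by norm_num)
  exact norm_le_zero_iff.mp (ge_of_tendsto' hlim fun n => key n t ht)

/-! ### Identification of `Y_0 - H_0` with the Laplace transform -/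

section Difference

/-- The sum of the Laplace transform of `1 / √(1 + ξ²)` and the series for `(π / 2)(Y_0 - H_0)`. -/
noncomputable def besselDefect (z : ℂ) : ℂ :=
  laplaceMoment 0 z + (Complex.log (z / 2) * seriesSum besselCoeff (z ^ 2 / 4) +
    seriesSum weberCoeff (z ^ 2 / 4) - Real.pi / 4 * z * seriesSum struveCoeff (z ^ 2 / 4))

/-- The Euler derivative `z dD/dz` of `D = besselDefect`. -/
noncomputable def besselDefectEuler (z : ℂ) : ℂ :=
  z * laplaceMoment 1 z + (seriesSum besselCoeff (z ^ 2 / 4) +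
    2 * Complex.log (z / 2) * seriesSum (fun k => (k : ℂ) * besselCoeff k) (z ^ 2 / 4) +
    2 * seriesSum (fun k => (k : ℂ) * weberCoeff k) (z ^ 2 / 4) -
    Real.pi / 4 * z * (seriesSum struveCoeff (z ^ 2 / 4) +
      2 * seriesSum (fun k => (k : ℂ) * struveCoeff k) (z ^ 2 / 4)))

theorem ne_zero_of_re_pos {z : ℂ} (hz : 0 < z.re) : z ≠ 0 := by
  rintro rfl
  simp at hz

theorem hasDerivAt_log_half {z : ℂ} (hz : 0 < z.re) :
    HasDerivAt (fun y : ℂ => Complex.log (y / 2)) (1 / z) z := by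
  have h : z / 2 ∈ Complex.slitPlane := Or.inl (by simpa using hz)
  refine (((hasDerivAt_id z).div_const 2).clog h).congr_deriv ?_
  have := ne_zero_of_re_pos hz
  simp only [id]
  field_simp

theorem hasDerivAt_besselDefect {z : ℂ} (hz : 0 < z.re) :
    HasDerivAt besselDefect (besselDefectEuler z / z) z := by
  have hz0 := ne_zero_of_re_pos hz
  have hF := hasDerivAt_laplaceMoment 0 hz
  have hL := hasDerivAt_log_half hz
  have hA := isEntireCoeff_besselCoeff.hasDerivAt_comp_sq_div_four hz0
  have hB := isEntireCoeff_weberCoeff.hasDerivAt_comp_sq_div_four hz0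
  have hH := isEntireCoeff_struveCoeff.hasDerivAt_comp_sq_div_four hz0
  refine (hF.add (((hL.mul hA).add hB).sub
    (((hasDerivAt_id z).const_mul (Real.pi / 4 : ℂ)).mul hH))).congr_deriv ?_
  simp only [besselDefectEuler, id, zero_add]
  field_simp

/-- The constant inhomogeneities of the Laplace transform and of the Struve part cancel, leaving the
homogeneous Bessel equation. -/
theorem hasDerivAt_besselDefectEuler {z : ℂ} (hz : 0 < z.re) :
    HasDerivAt besselDefectEuler (-z * besselDefect z) z := by
  have hz0 := ne_zero_of_re_pos hz
  have hpi : (Real.pi : ℂ) ≠ 0 := Complex.ofReal_ne_zero.mpr Real.pi_ne_zero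
  have hF := (hasDerivAt_id z).mul (hasDerivAt_laplaceMoment 1 hz)
  have hL := hasDerivAt_log_half hz
  have hA := isEntireCoeff_besselCoeff.hasDerivAt_comp_sq_div_four hz0
  have hA' := isEntireCoeff_besselCoeff.natCast_mul.hasDerivAt_comp_sq_div_four hz0
  have hB' := isEntireCoeff_weberCoeff.natCast_mul.hasDerivAt_comp_sq_div_four hz0
  have hH := isEntireCoeff_struveCoeff.hasDerivAt_comp_sq_div_four hz0
  have hH' := isEntireCoeff_struveCoeff.natCast_mul.hasDerivAt_comp_sq_div_four hz0
  refine (hF.add (((hA.add ((hL.const_mul 2).mul hA')).add (hB'.const_mul 2)).sub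
    (((hasDerivAt_id z).const_mul (Real.pi / 4 : ℂ)).mul
      (hH.add (hH'.const_mul 2))))).congr_deriv ?_
  have e1 := laplaceMoment_bessel_equation hz
  have e2 := seriesSum_bessel_equation (z ^ 2 / 4)
  have e3 := seriesSum_weber_equation (z ^ 2 / 4)
  have e4 := seriesSum_struve_equation (z ^ 2 / 4)
  simp only [besselDefect, id, Nat.reduceAdd, Pi.add_apply]
  set A1 := seriesSum (fun k => (k : ℂ) * besselCoeff k) (z ^ 2 / 4)
  set A2 := seriesSum (fun k => (k : ℂ) * (k * besselCoeff k)) (z ^ 2 / 4)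
  set B2 := seriesSum (fun k => (k : ℂ) * (k * weberCoeff k)) (z ^ 2 / 4)
  set H0 := seriesSum struveCoeff (z ^ 2 / 4)
  set H1 := seriesSum (fun k => (k : ℂ) * struveCoeff k) (z ^ 2 / 4)
  set H2 := seriesSum (fun k => (k : ℂ) * (k * struveCoeff k)) (z ^ 2 / 4)
  have e4' : (Real.pi : ℂ) * (H0 + 4 * H1 + 4 * H2) = 4 - Real.pi * z ^ 2 * H0 := by
    rw [e4]
    field_simp
  field_simp
  linear_combination 4 * z * e1 + 16 * Complex.log (z / 2) * e2 + 16 * e3 - z * e4'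

theorem tendsto_seriesSum_sq_div_four {c : ℕ → ℂ} (hc : IsEntireCoeff c) :
    Tendsto (fun t : ℝ => seriesSum c ((t : ℂ) ^ 2 / 4)) (𝓝[>] 0) (𝓝 (c 0)) := by
  have h : Continuous fun t : ℝ => seriesSum c ((t : ℂ) ^ 2 / 4) :=
    hc.continuous.comp (by fun_prop)
  have h' := h.tendsto 0
  simp only [Complex.ofReal_zero, zero_pow two_ne_zero, zero_div, seriesSum_zero] at h'
  exact h'.mono_left nhdsWithin_le_nhds

theorem tendsto_ofReal_nhdsGT_zero : Tendsto (fun t : ℝ => (t : ℂ)) (𝓝[>] 0) (𝓝 0) :=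
  (Complex.continuous_ofReal.tendsto 0).mono_left nhdsWithin_le_nhds

theorem log_ofReal_div_two {t : ℝ} (ht : 0 < t) :
    Complex.log ((t : ℂ) / 2) = ((Real.log t - Real.log 2 : ℝ) : ℂ) := by
  rw [← Real.log_div ht.ne' two_ne_zero, Complex.ofReal_log (by positivity)]
  push_cast
  rfl

/-- The logarithm times a power series that vanishes at the origin tends to zero there. -/
theorem tendsto_log_mul_seriesSum_sub {c : ℕ → ℂ} (hc : IsEntireCoeff c) :
    Tendsto (fun t : ℝ => Complex.log ((t : ℂ) / 2) * (seriesSum c ((t : ℂ) ^ 2 / 4) - c 0))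
      (𝓝[>] 0) (𝓝 0) := by
  have h1 : Tendsto (fun t : ℝ => (Real.log t - Real.log 2) * t) (𝓝[>] 0) (𝓝 0) := by
    have h2 : Tendsto (fun t : ℝ => Real.log 2 * t) (𝓝[>] 0) (𝓝 (Real.log 2 * 0)) :=
      Tendsto.mono_left (Continuous.tendsto (by fun_prop) 0) nhdsWithin_le_nhds
    have h3 : Tendsto (fun t : ℝ => Real.log t * t) (𝓝[>] 0) (𝓝 0) := by
      simpa using tendsto_log_mul_rpow_nhdsGT_zero one_pos
    simpa [sub_mul] using h3.sub h2
  have h4 := ((Complex.continuous_ofReal.tendsto 0).comp h1).mul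
    (tendsto_ofReal_nhdsGT_zero.mul (tendsto_seriesSum_sq_div_four hc.shift))
  rw [zero_mul, mul_zero] at h4
  have h5 := h4.div_const 4
  rw [zero_div] at h5
  refine h5.congr' ?_
  filter_upwards [self_mem_nhdsWithin] with t ht
  rw [seriesSum_eq_zero_add_mul hc (e := fun k => c (k + 1)) (r := 1) (by simp),
    log_ofReal_div_two ht, Function.comp_apply]
  push_cast
  ring

/-- The terms `log t` cancel, and the constants `log 2 - γ`, `-log 2` and `γ` add up to zero. -/
theorem tendsto_besselDefect : Tendsto (fun t : ℝ => besselDefect t) (𝓝[>] 0) (𝓝 0) := by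
  have h1 := tendsto_laplaceMoment_zero_add_log
  have h2 := tendsto_log_mul_seriesSum_sub isEntireCoeff_besselCoeff
  have h3 := tendsto_seriesSum_sq_div_four isEntireCoeff_weberCoeff
  have h4 := (tendsto_ofReal_nhdsGT_zero.const_mul (Real.pi / 4 : ℂ)).mul
    (tendsto_seriesSum_sq_div_four isEntireCoeff_struveCoeff)
  have h5 := ((h1.sub_const (Real.log 2 : ℂ)).add h2).add (h3.sub h4)
  have hw : weberCoeff 0 = Real.eulerMascheroniConstant := by
    simp [weberCoeff, rgammaDeriv_zero]
  rw [hw, mul_zero, zero_mul] at h5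
  have h0 : ((Real.log 2 - Real.eulerMascheroniConstant : ℝ) : ℂ) - (Real.log 2 : ℂ) + 0 +
      ((Real.eulerMascheroniConstant : ℂ) - 0) = 0 := by
    push_cast
    ring
  rw [h0] at h5
  refine h5.congr' ?_
  filter_upwards [self_mem_nhdsWithin] with t ht
  rw [besselDefect, log_ofReal_div_two ht, show besselCoeff 0 = 1 by simp [besselCoeff]]
  push_cast
  ring

/-- The limit `-1` of `t F'(t)` cancels against `J_0(0) = 1`, the derivative of the logarithm. -/
theorem tendsto_besselDefectEuler :
    Tendsto (fun t : ℝ => besselDefectEuler t) (𝓝[>] 0) (𝓝 0) := by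
  have h1 := tendsto_mul_laplaceMoment_one
  have h2 := tendsto_seriesSum_sq_div_four isEntireCoeff_besselCoeff
  have h3 := (tendsto_log_mul_seriesSum_sub isEntireCoeff_besselCoeff.natCast_mul).const_mul 2
  have h4 := (tendsto_seriesSum_sq_div_four isEntireCoeff_weberCoeff.natCast_mul).const_mul 2
  have h5 := (tendsto_ofReal_nhdsGT_zero.const_mul (Real.pi / 4 : ℂ)).mul
    ((tendsto_seriesSum_sq_div_four isEntireCoeff_struveCoeff).add
      ((tendsto_seriesSum_sq_div_four isEntireCoeff_struveCoeff.natCast_mul).const_mul 2))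
  have h6 := h1.add (((h2.add h3).add h4).sub h5)
  simp only [show besselCoeff 0 = 1 by simp [besselCoeff], Nat.cast_zero, zero_mul, mul_zero,
    add_zero, sub_zero, neg_add_cancel, mul_one] at h6
  refine h6.congr fun t => ?_
  rw [besselDefectEuler]
  ring

/-- Uniqueness gives zero on a real interval `(0, ε)`; the identity theorem extends this to the
connected half-plane. -/
theorem besselDefect_eq_zero {z : ℂ} (hz : 0 < z.re) : besselDefect z = 0 := by
  have hev : ∀ᶠ t : ℝ in 𝓝[>] 0, besselDefect t = 0 := by
    refine eventually_eq_zero_of_bessel_system (D := fun t : ℝ => besselDefect t)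
      (E := fun t : ℝ => besselDefectEuler t) (fun t ht => ?_) (fun t ht => ?_)
      tendsto_besselDefect tendsto_besselDefectEuler
    · exact (hasDerivAt_besselDefect (z := t) (by simpa using ht)).comp_ofReal
    · exact (hasDerivAt_besselDefectEuler (z := t) (by simpa using ht)).comp_ofReal
  obtain ⟨ε, hε, hsub⟩ := mem_nhdsGT_iff_exists_Ioo_subset.mp hev
  have hε : 0 < ε := hε
  have han : AnalyticOnNhd ℂ besselDefect {y : ℂ | 0 < y.re} :=
    DifferentiableOn.analyticOnNhd
      (fun y hy => (hasDerivAt_besselDefect hy).differentiableAt.differentiableWithinAt)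
      (isOpen_lt continuous_const Complex.continuous_re)
  have hpre : IsPreconnected {y : ℂ | 0 < y.re} := (convex_halfSpace_re_gt 0).isPreconnected
  have hfreq : ∃ᶠ y in 𝓝[≠] ((ε / 2 : ℝ) : ℂ), besselDefect y = 0 := by
    have hmap : Tendsto (fun t : ℝ => (t : ℂ)) (𝓝[≠] (ε / 2)) (𝓝[≠] ((ε / 2 : ℝ) : ℂ)) :=
      tendsto_nhdsWithin_of_tendsto_nhds_of_eventually_within _
        ((Complex.continuous_ofReal.tendsto _).mono_left nhdsWithin_le_nhds)
        (by
          filter_upwards [self_mem_nhdsWithin] with t ht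
          exact fun h => ht (Complex.ofReal_injective h))
    refine hmap.frequently (Eventually.frequently ?_)
    have : Ioo 0 ε ∈ 𝓝 (ε / 2) := Ioo_mem_nhds (half_pos hε) (half_lt_self hε)
    filter_upwards [nhdsWithin_le_nhds this] with t ht using hsub ht
  exact han.eqOn_zero_of_preconnected_of_frequently_eq_zero hpre
    (show ((ε / 2 : ℝ) : ℂ) ∈ {y : ℂ | 0 < y.re} by simpa using hε) hfreq hz

/-- `Y_0 - H_0` is `-2 / π` times the Laplace transform of `1 / √(1 + ξ²)`. -/
theorem weberStruve_eq {z : ℂ} (hz : 0 < z.re) :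
    weberStruve z = -(2 / Real.pi) * laplaceMoment 0 z := by
  have hpi : (Real.pi : ℂ) ≠ 0 := Complex.ofReal_ne_zero.mpr Real.pi_ne_zero
  have h := besselDefect_eq_zero hz
  rw [besselDefect, ← half_pi_mul_weberStruve (ne_zero_of_re_pos hz)] at h
  field_simp at h ⊢
  linear_combination h

theorem weberStruve_eventuallyEq {z : ℂ} (hz : 0 < z.re) :
    weberStruve =ᶠ[𝓝 z] fun y => -(2 / Real.pi : ℂ) * laplaceMoment 0 y := by
  filter_upwards [(isOpen_lt continuous_const Complex.continuous_re).mem_nhds hz] with y hy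
  exact weberStruve_eq hy

theorem analyticAt_weberStruve {z : ℂ} (hz : 0 < z.re) : AnalyticAt ℂ weberStruve z :=
  (analyticAt_const.mul (analyticOnNhd_laplaceMoment 0 z hz)).congr
    (weberStruve_eventuallyEq hz).symm

theorem iteratedDeriv_weberStruve (l : ℕ) {z : ℂ} (hz : 0 < z.re) :
    iteratedDeriv l weberStruve z = -(2 / Real.pi) * laplaceMoment l z := by
  rw [(weberStruve_eventuallyEq hz).iteratedDeriv_eq, iteratedDeriv_const_mul_field,
    iteratedDeriv_laplaceMoment_zero l hz]

end Difference

/-! ### The first-kind functions in terms of the Laplace transform -/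

section FirstKind

/-- The square root of `e^{-ξ}` is `e^{-ξ/2}`, which joins `e^{ixξ}` to `e^{-zξ}` with `z = 1/2 -
ix`; the signs of `L_n` go into `(-ξ)^l`. -/
theorem firstKindIntegrand_laguerre (n : ℕ) (x : ℝ) :
    firstKindIntegrand laguerreWeight (laguerre n) 1 x =
      (Ici (0 : ℝ)).indicator fun ξ => ∑ l ∈ Finset.range (n + 1),
        (n.choose l : ℂ) * (1 / (l ! : ℂ)) * ((-(ξ : ℂ)) ^ l *
          Complex.exp (-(1 / 2 - Complex.I * x) * ξ) * ((Real.sqrt (1 + ξ ^ 2))⁻¹ : ℝ)) := by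
  ext ξ
  by_cases hξ : ξ ∈ Ici (0 : ℝ)
  · rw [indicator_of_mem hξ, firstKindIntegrand, laguerreWeight, indicator_of_mem hξ]
    have hsum : ∑ k ∈ Finset.range (1 + 1), ξ ^ (2 * k) = 1 + ξ ^ 2 := by
      simp [Finset.sum_range_succ]
    have hexp : Complex.exp (-(1 / 2 - Complex.I * x) * ξ) =
        Complex.exp (Complex.I * x * ξ) * (Real.exp (-ξ / 2) : ℂ) := by
      rw [Complex.ofReal_exp, ← Complex.exp_add]
      congr 1
      push_cast
      ring
    rw [hsum, Real.sqrt_div (Real.exp_pos _).le, ← Real.exp_half, eval_laguerre, hexp,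
      div_eq_mul_inv (Real.exp (-ξ / 2))]
    push_cast
    rw [Finset.mul_sum, Finset.sum_mul]
    refine Finset.sum_congr rfl fun l _ => ?_
    rw [neg_pow (ξ : ℂ) l]
    ring
  · rw [indicator_of_notMem hξ, firstKindIntegrand, laguerreWeight, indicator_of_notMem hξ]
    simp

theorem integrable_firstKindIntegrand_laguerre (n : ℕ) (x : ℝ) :
    Integrable (firstKindIntegrand laguerreWeight (laguerre n) 1 x) := by
  rw [firstKindIntegrand_laguerre, integrable_indicator_iff measurableSet_Ici,
    integrableOn_Ici_iff_integrableOn_Ioi]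
  exact integrable_finsetSum _ fun l _ =>
    (integrableOn_laplaceMoment l (z := 1 / 2 - Complex.I * x) (by simp)).const_mul _

theorem integral_firstKindIntegrand_laguerre (n : ℕ) (x : ℝ) :
    ∫ ξ : ℝ, firstKindIntegrand laguerreWeight (laguerre n) 1 x ξ =
      ∑ l ∈ Finset.range (n + 1), (n.choose l : ℂ) * (1 / (l ! : ℂ)) *
        laplaceMoment l (1 / 2 - Complex.I * x) := by
  rw [firstKindIntegrand_laguerre, integral_indicator measurableSet_Ici,
    integral_Ici_eq_integral_Ioi, integral_finsetSum _ fun l _ =>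
    (integrableOn_laplaceMoment l (z := 1 / 2 - Complex.I * x) (by simp)).const_mul _]
  simp_rw [integral_const_mul]
  rfl

theorem integrable_firstKindIntegrand_mirror (n : ℕ) (x : ℝ) :
    Integrable (firstKindIntegrand mirrorWeight (mirrorLaguerre n) 1 x) := by
  rw [show firstKindIntegrand mirrorWeight (mirrorLaguerre n) 1 x = fun ξ =>
    -conj (firstKindIntegrand laguerreWeight (laguerre n) 1 x (-ξ)) from
      funext (firstKindIntegrand_mirror n x)]
  have h := (integrable_firstKindIntegrand_laguerre n x).comp_neg
  exact (Complex.conjCLE.toContinuousLinearMap.integrable_comp h).neg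

theorem sobolevLaguerre_eq (n : ℕ) (x : ℝ) :
    sobolevLaguerre n x =
      -((Real.sqrt (2 * Real.pi) : ℝ) / 4 : ℂ) * Complex.I ^ n *
        ∑ l ∈ Finset.range (n + 1), (n.choose l : ℂ) * (1 / (l ! : ℂ)) *
          iteratedDeriv l weberStruve (1 / 2 - Complex.I * x) := by
  have hz : 0 < (1 / 2 - Complex.I * x : ℂ).re := by simp
  have hpi : (Real.pi : ℂ) ≠ 0 := Complex.ofReal_ne_zero.mpr Real.pi_ne_zero
  have hs0 : (Real.sqrt (2 * Real.pi) : ℂ) ≠ 0 :=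
    Complex.ofReal_ne_zero.mpr (Real.sqrt_pos.mpr (by positivity)).ne'
  have hs : (Real.sqrt (2 * Real.pi) : ℂ) * (Real.sqrt (2 * Real.pi) : ℂ) = 2 * Real.pi := by
    rw [← Complex.ofReal_mul, Real.mul_self_sqrt (by positivity)]
    push_cast
    rfl
  have hconst : 1 / (Real.sqrt (2 * Real.pi) : ℂ) =
      (Real.sqrt (2 * Real.pi) : ℂ) / 4 * (2 / Real.pi) := by
    field_simp
    rw [sq, hs]
    ring
  rw [sobolevLaguerre_natCast, firstKind, integral_firstKindIntegrand_laguerre]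
  simp_rw [iteratedDeriv_weberStruve _ hz, mul_left_comm _ (-(2 / Real.pi : ℂ))]
  rw [← Finset.mul_sum, div_eq_mul_one_div, hconst]
  ring

end FirstKind

end SobolevLaguerre

open SobolevLaguerre in
theorem mainTheorem7 :
    -- the polynomials used for the two weights are orthonormal polynomials
    IsOrthonormalSystem laguerreWeight laguerre ∧
    IsOrthonormalSystem mirrorWeight mirrorLaguerre ∧
    -- the explicit form for indices `n ≥ 0`; integral and derivatives exist
    (∀ (n : ℕ) (x : ℝ),
      MeasureTheory.Integrable (firstKindIntegrand laguerreWeight (laguerre n) 1 x) ∧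
      AnalyticAt ℂ weberStruve (1 / 2 - Complex.I * x) ∧
      sobolevLaguerre n x =
        -((Real.sqrt (2 * Real.pi) : ℝ) / 4 : ℂ) * Complex.I ^ n *
          ∑ l ∈ Finset.range (n + 1),
            (n.choose l : ℂ) * (1 / (l ! : ℂ)) *
              iteratedDeriv l weberStruve (1 / 2 - Complex.I * x)) ∧
    -- the functions of negative index
    (∀ (n : ℕ) (x : ℝ),
      MeasureTheory.Integrable (firstKindIntegrand mirrorWeight (mirrorLaguerre n) 1 x) ∧
      sobolevLaguerre (-(n : ℤ) - 1) x = (-1) ^ (n + 1) * conj (sobolevLaguerre n x)) ∧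
    -- any other choice of orthonormal polynomials for the mirrored weight changes only the sign
    (∀ q : ℕ → Polynomial ℝ, IsOrthonormalSystem mirrorWeight q → ∀ n : ℕ,
      ((q n).eval 0 = 1 ∨ (q n).eval 0 = -1) ∧
      ∀ x : ℝ, firstKind mirrorWeight q 1 n x =
        (-1) ^ n * ((q n).eval 0 : ℝ) * conj (sobolevLaguerre n x)) :=
  ⟨isOrthonormalSystem_laguerre, isOrthonormalSystem_mirrorLaguerre,
    fun n x => ⟨integrable_firstKindIntegrand_laguerre n x, analyticAt_weberStruve (by simp),
      sobolevLaguerre_eq n x⟩,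
    fun n x => ⟨integrable_firstKindIntegrand_mirror n x, sobolevLaguerre_neg_sub_one n x⟩,
    fun _ hq n => firstKind_mirror_of_isOrthonormalSystem hq n⟩
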